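/- Let $X$ be a complex Banach space, let $-A$ be the generator of a bounded $C_0$-semigroup $(e^{-tA})_{t\ge 0}$ on $X$, and let $M:=\sup_{t\ge 0}\|e^{-tA}\|$. Let $(g_t)_{t>0}$ be a family of completely monotone functions on $(0,\infty)$, that is, $g_t\in C^\infty(0,\infty)$ and $(-1)^k g_t^{(k)}\ge 0$ on $(0,\infty)$ for all $k\ge 0$. Put $g_t^{(k)}(0):=\lim_{z\to 0+}g_t^{(k)}(z)$ and assume that for every $t>0$ $$g_t(0)=1,\qquad g_t'(0)=-1,\qquad g_t''(0)<\infty .$$ For a bounded completely monotone function $g(z)=\int_0^\infty e^{-zs}\,\nu(ds)$ ($z>0$), with its unique representing positive bounded Borel measure $\nu$ on $[0,\infty)$, set $g(A)x:=\int_0^\infty e^{-sA}x\,\nu(ds)$, and write $g_t^n(tA/n)$ for the operator obtained in this way from the function $z\mapsto g_t(tz/n)^n$. For $\alpha>0$ the fractional power $A^\alpha$ is given by the extended Hille–Phillips calculus: $A^\alpha=e(A)^{-1}(ef)(A)$ with its natural domain $\{x:(ef)(A)x\in\operatorname{ran}e(A)\}$, where $f(z)=z^\alpha$, $e$ is any function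 such that $e$ and $ef$ are Laplace transforms, on the open right half-plane, of bounded complex Borel measures on $[0,\infty)$ and $e(A)$ is injective, and where $h(A)x=\int_0^\infty e^{-sA}x\,\mu(ds)$ if $h$ is the Laplace transform of $\mu$; the operator does not depend on the choice of $e$. Then for all integers $n\ge 1$ and all $t>0$: $$\|g_t^n(tA/n)x-e^{-tA}x\|\le M\,\frac{g_t''(0)-1}{2}\,\frac{t^2}{n}\,\|A^2x\|,\qquad x\in\operatorname{dom}(A^2),$$ $$\|g_t^n(tA/n)x-e^{-tA}x\|\le M\,(g_t''(0)-1)^{1/2}\,\frac{t}{\sqrt n}\,\|Ax\|,\qquad x\in\operatorname{dom}(A),$$ and, for every $\alpha\in(0,2)$, $$\|g_t^n(tA/n)x-e^{-tA}x\|\le 4M\left((g_t''(0)-1)\frac{t^2}{n}\right)^{\alpha/2}\|A^\alpha x\|,\qquad x\in\operatorname{dom}(A^\alpha).$$ -/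

import Mathlib

open MeasureTheory Filter Set
open scoped Topology NNReal ContDiff

noncomputable section

/-! ### Bounded strongly continuous semigroups and their generators -/

/-- A bounded `C₀`-semigroup `(T s)_{s ≥ 0}` of bounded linear operators on a complex normed
space `X`. -/
structure BoundedC0Semigroup (X : Type*) [NormedAddCommGroup X] [NormedSpace ℂ X] where
  /-- the operator at time `s` -/
  op : ℝ≥0 → X →L[ℂ] X
  op_zero : op 0 = ContinuousLinearMap.id ℂ X
  op_add : ∀ s r, op (s + r) = (op s).comp (op r)
  continuous_orbit : ∀ x, Continuous fun s => op s x
  bounded : ∃ C : ℝ, ∀ s, ‖op s‖ ≤ C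

namespace BoundedC0Semigroup

variable {X : Type*} [NormedAddCommGroup X] [NormedSpace ℂ X]

/-- The bound `sup_{s ≥ 0} ‖T s‖`. -/
def bound (T : BoundedC0Semigroup X) : ℝ := ⨆ s : ℝ≥0, ‖T.op s‖

/-- The infinitesimal generator of a semigroup: `x ↦ lim_{h → 0+} (T h x - x) / h`, with domain
the set of all `x` for which this limit exists. -/
def generator (T : BoundedC0Semigroup X) : X →ₗ.[ℂ] X where
  domain :=
    { carrier := {x | ∃ y, Tendsto (fun h : ℝ≥0 => ((h : ℝ)⁻¹ : ℂ) • (T.op h x - x)) (𝓝[>] 0) (𝓝 y)}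
      zero_mem' := ⟨0, by simp⟩
      add_mem' := by
        rintro a b ⟨y, hy⟩ ⟨z, hz⟩
        refine ⟨y + z, (hy.add hz).congr fun h => ?_⟩
        rw [← smul_add, map_add]
        congr 1
        abel
      smul_mem' := by
        rintro c a ⟨y, hy⟩
        refine ⟨c • y, (hy.const_smul c).congr fun h => ?_⟩
        rw [smul_comm, map_smul, smul_sub] }
  toFun :=
    { toFun := fun x => x.2.choose
      map_add' := by
        intro a b
        refine tendsto_nhds_unique (a + b).2.choose_spec
          ((a.2.choose_spec.add b.2.choose_spec).congr fun h => ?_)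
        rw [← smul_add, Submodule.coe_add, map_add]
        congr 1
        abel
      map_smul' := by
        intro c a
        refine tendsto_nhds_unique (c • a).2.choose_spec
          ((a.2.choose_spec.const_smul c).congr fun h => ?_)
        rw [smul_comm, Submodule.coe_smul, map_smul, smul_sub] }

lemma integrable_orbit (T : BoundedC0Semigroup X) (ν : FiniteMeasure ℝ≥0) (x : X) :
    Integrable (fun s => T.op s x) (ν : Measure ℝ≥0) := by
  obtain ⟨C, hC⟩ := T.bounded
  refine Integrable.of_bound (T.continuous_orbit x).aestronglyMeasurable (C * ‖x‖)
    (Eventually.of_forall fun s => ?_)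
  exact ((T.op s).le_opNorm x).trans (mul_le_mul_of_nonneg_right (hC s) (norm_nonneg x))

/-- For a finite positive Borel measure `ν` on `[0, ∞)`, the operator `x ↦ ∫ T s x dν(s)`. -/
def average (T : BoundedC0Semigroup X) (ν : FiniteMeasure ℝ≥0) : X →ₗ[ℂ] X where
  toFun x := ∫ s, T.op s x ∂(ν : Measure ℝ≥0)
  map_add' x y := by
    simp only [map_add]
    exact integral_add (T.integrable_orbit ν x) (T.integrable_orbit ν y)
  map_smul' c x := by
    simp only [map_smul, RingHom.id_apply]
    exact integral_smul c _

end BoundedC0Semigroup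

/-! ### Completely monotone functions -/

/-- `g` is completely monotone on `(0, ∞)`: it is smooth there and `(-1)^k g^{(k)} ≥ 0` for every
`k ≥ 0`. The values of `g` outside `(0, ∞)` are irrelevant. -/
def CompletelyMonotone (g : ℝ → ℝ) : Prop :=
  ContDiffOn ℝ ∞ g (Ioi 0) ∧ ∀ k : ℕ, ∀ z : ℝ, 0 < z → 0 ≤ (-1 : ℝ) ^ k * iteratedDeriv k g z

/-- `g^{(k)}(0) = c`, where `g^{(k)}(0)` is understood as the limit of `g^{(k)}(z)` as
`z → 0+`; here the limit is finite, since `c` is a real number. -/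
def HasDerivLimitAtZero (k : ℕ) (g : ℝ → ℝ) (c : ℝ) : Prop :=
  Tendsto (iteratedDeriv k g) (𝓝[>] 0) (𝓝 c)

/-- `g` is the Laplace transform on `(0, ∞)` of the finite positive measure `ν`. -/
def IsPosLaplace (g : ℝ → ℝ) (ν : FiniteMeasure ℝ≥0) : Prop :=
  ∀ z : ℝ, 0 < z → g z = ∫ s, Real.exp (-(z * (s : ℝ))) ∂(ν : Measure ℝ≥0)

open Classical in
/-- The (unique) finite positive measure on `[0, ∞)` whose Laplace transform is `g`. It exists
exactly when `g` is bounded and completely monotone on `(0, ∞)`; otherwise the value is `0`. -/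
def bernsteinMeasure (g : ℝ → ℝ) : FiniteMeasure ℝ≥0 :=
  if h : ∃ ν, IsPosLaplace g ν then h.choose else 0

/-! ### The Hille-Phillips functional calculus -/

/-- The open right half-plane. -/
def rightHalfPlane : Set ℂ := {z | 0 < z.re}

/-- `f` is, on the open right half-plane, the Laplace transform of the bounded complex Borel
measure `μ 0 + i μ 1 - μ 2 - i μ 3` on `[0, ∞)`. Every bounded complex Borel measure is a
combination of this form of finite positive measures. -/
def IsLaplace (f : ℂ → ℂ) (μ : Fin 4 → FiniteMeasure ℝ≥0) : Prop :=
  ∀ z ∈ rightHalfPlane,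
    f z = ∑ k : Fin 4, Complex.I ^ (k : ℕ) *
      ∫ s, Complex.exp (-(z * ((s : ℝ) : ℂ))) ∂(μ k : Measure ℝ≥0)

/-- Membership in the algebra of Laplace transforms of bounded complex Borel measures. -/
def InLaplaceAlgebra (f : ℂ → ℂ) : Prop := ∃ μ, IsLaplace f μ

namespace BoundedC0Semigroup

variable {X : Type*} [NormedAddCommGroup X] [NormedSpace ℂ X]

/-- The operator `g(A) x = ∫ e^{-sA} x ν(ds)` for a bounded completely monotone function `g` with
representing measure `ν`, where `e^{-sA} = T s`. -/
def cmCalc (T : BoundedC0Semigroup X) (g : ℝ → ℝ) : X →ₗ[ℂ] X :=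
  T.average (bernsteinMeasure g)

open Classical in
/-- The Hille-Phillips calculus: `f(A) x = ∫ e^{-sA} x μ(ds)` if `f` is the Laplace transform of
the bounded complex measure `μ`, where `e^{-sA} = T s`. The value does not depend on the
representation of `f`; it is `0` if there is none. -/
def hpCalc (T : BoundedC0Semigroup X) (f : ℂ → ℂ) : X →ₗ[ℂ] X :=
  if h : InLaplaceAlgebra f then
    ∑ k : Fin 4, Complex.I ^ (k : ℕ) • T.average (h.choose k)
  else 0

/-- `e` is a regularizer for `f`: both `e` and `e f` belong to the algebra of Laplace transforms,
and the operator `e(A)` is injective. -/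
def IsRegularizer (T : BoundedC0Semigroup X) (f e : ℂ → ℂ) : Prop :=
  InLaplaceAlgebra e ∧ InLaplaceAlgebra (fun z => e z * f z) ∧
    Function.Injective (T.hpCalc e)

/-- The operator `e(A)⁻¹ (e f)(A)` with domain `{x | (e f)(A) x ∈ ran e(A)}`, for a regularizer `e`
of `f`. -/
def regularized (T : BoundedC0Semigroup X) (f e : ℂ → ℂ) (h : T.IsRegularizer f e) :
    X →ₗ.[ℂ] X where
  domain := (LinearMap.range (T.hpCalc e)).comap (T.hpCalc fun z => e z * f z)
  toFun :=
    (LinearEquiv.ofInjective (T.hpCalc e) h.2.2).symm.toLinearMap.comp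
      ((T.hpCalc fun z => e z * f z).restrict fun _ hx => hx)

open Classical in
/-- The extended Hille-Phillips calculus: `f(A) = e(A)⁻¹ (e f)(A)` for a holomorphic function `f`
on the open right half-plane that has a regularizer `e`. The operator does not depend on the choice
of the regularizer. For functions without a regularizer the value is the operator with
domain `{0}`. -/
def extCalc (T : BoundedC0Semigroup X) (f : ℂ → ℂ) : X →ₗ.[ℂ] X :=
  if h : DifferentiableOn ℂ f rightHalfPlane ∧ ∃ e, T.IsRegularizer f e then
    T.regularized f h.2.choose h.2.choose_spec
  else ⊥

/-- The fractional power `A^α`, `α > 0`, where `-A` is the generator of `T`: the function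
`z ↦ z^α` (principal branch) is inserted into the extended Hille-Phillips calculus. -/
def fracPow (T : BoundedC0Semigroup X) (α : ℝ) : X →ₗ.[ℂ] X :=
  T.extCalc fun z => z ^ (α : ℂ)

end BoundedC0Semigroup

end

/-! The argument is probabilistic. By Bernstein's theorem (`CompletelyMonotone.exists_isPosLaplace`)
each `g_t` is the Laplace transform of a measure, and the values at `0` of `g_t` and its first two
derivatives make it a probability measure with mean `1` and variance `g_t''(0) - 1`. Hence `z ↦
g_t(tz/n)^n` is the transform of the law `μ` of `(t/n)(s₁ + ⋯ + sₙ)` with independent `sᵢ`, whose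
mean is `t` and whose variance is `V = (g_t''(0) - 1) t²/n`
(`CompletelyMonotone.bernsteinMeasure_pow`). The approximant is thus the orbit averaged over a
random time, compared with the orbit at the mean time.

On `dom(A)` the orbit is Lipschitz with constant `M‖Ax‖`, and `E|s - t| ≤ √V`. On `dom(A²)` the
orbit is expanded at `t`: the linear term averages to zero because the mean is `t`, and the
remainder is at most `M‖A²x‖ (s - t)²/2`.

For fractional powers put `D(z) = Lμ(z) - e^{-tz}`. The same two ideas show that `D`, `D/z`, `D/z²`
are transforms of signed measures of total variation at most `2`, `√V`, `V/2`. In `Γ(α) z^{-α} = ∫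
u^{α-1} e^{-zu} du` the range is split at a level `σ` with `V ≤ σ²`; two integrations by parts on
`(σ, ∞)` produce factors `1/z` and `1/z²` for `D` to absorb, and `D(z) z^{-α}` has total variation
at most `4σ^α` (`isSignedLaplace_sub_exp_mul_rpow`). Uniqueness of Laplace transforms and
injectivity of `e(A)` turn `D = (D z^{-α}) z^α` into an operator identity on `dom(A^α)`
(`average_sub_average_eq_of_regularizer`), and `σ` decreases to `√V`. -/

noncomputable section

/-! ### Bernstein's theorem -/

namespace CompletelyMonotone

variable {g : ℝ → ℝ}

/-- The nonnegative function `(-1)^k g^{(k)}`. -/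
def signedDeriv (g : ℝ → ℝ) (k : ℕ) (z : ℝ) : ℝ := (-1 : ℝ) ^ k * iteratedDeriv k g z

lemma contDiffAt (hg : CompletelyMonotone g) {z : ℝ} (hz : 0 < z) : ContDiffAt ℝ ∞ g z :=
  hg.1.contDiffAt (Ioi_mem_nhds hz)

lemma signedDeriv_nonneg (hg : CompletelyMonotone g) (k : ℕ) {z : ℝ} (hz : 0 < z) :
    0 ≤ signedDeriv g k z := hg.2 k z hz

lemma hasDerivAt_signedDeriv (hg : CompletelyMonotone g) (k : ℕ) {z : ℝ} (hz : 0 < z) :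
    HasDerivAt (signedDeriv g k) (-signedDeriv g (k + 1) z) z := by
  have h : DifferentiableAt ℝ (iteratedDeriv k g) z := by
    have := (hg.contDiffAt hz).differentiableAt_iteratedFDeriv (m := k) (mod_cast ENat.natCast_lt_top k)
    rw [iteratedDeriv_eq_equiv_comp]
    exact (LinearIsometryEquiv.differentiable _).differentiableAt.comp z this
  have := (h.hasDerivAt.const_mul ((-1 : ℝ) ^ k))
  rw [← iteratedDeriv_succ] at this
  refine this.congr_deriv ?_
  simp only [signedDeriv, pow_succ]
  ring

lemma antitoneOn_signedDeriv (hg : CompletelyMonotone g) (k : ℕ) :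
    AntitoneOn (signedDeriv g k) (Ioi 0) := by
  refine antitoneOn_of_deriv_nonpos (convex_Ioi 0)
    (fun z hz => (hg.hasDerivAt_signedDeriv k hz).continuousAt.continuousWithinAt)
    (fun z hz => ?_) (fun z hz => ?_) <;> rw [interior_Ioi] at hz
  · exact (hg.hasDerivAt_signedDeriv k hz).differentiableAt.differentiableWithinAt
  · rw [(hg.hasDerivAt_signedDeriv k hz).deriv]
    exact neg_nonpos.2 (hg.signedDeriv_nonneg _ hz)

/-- The rescaled integral remainder in Taylor's formula for `g` at `a`. -/
def taylorRemainder (g : ℝ → ℝ) (a : ℝ) (n : ℕ) (z : ℝ) : ℝ :=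
  (n.factorial : ℝ)⁻¹ * ∫ t in (0 : ℝ)..1, (1 - t) ^ n * signedDeriv g (n + 1) (a + t * (z - a))

lemma segment_pos {a z t : ℝ} (ha : 0 < a) (hz : 0 < z) (ht : t ∈ Icc (0 : ℝ) 1) :
    0 < a + t * (z - a) := by
  rcases ht.1.eq_or_lt with h | h
  · simp [← h, ha]
  · nlinarith [ht.2, mul_pos h hz]

/-- Written in powers of `a - z`, so that for `z ≤ a` every term and the remainder are nonnegative.
-/
lemma taylor_formula (hg : CompletelyMonotone g) {a z : ℝ} (ha : 0 < a) (hz : 0 < z) (n : ℕ) :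
    g z = ∑ k ∈ Finset.range (n + 1), (a - z) ^ k / k.factorial * signedDeriv g k a +
      (a - z) ^ (n + 1) * taylorRemainder g a n z := by
  have key := map_add_eq_sum_add_integral_iteratedFDeriv (f := g) (x := a) (y := z - a) (n := n)
    (fun t ht => (hg.contDiffAt (by simpa using segment_pos ha hz ht)).of_le (mod_cast le_top))
  have hpow : ∀ (k : ℕ) (u : ℝ), iteratedFDeriv ℝ k g u (fun _ => z - a) =
      (a - z) ^ k * signedDeriv g k u := by
    intro k u
    rw [iteratedFDeriv_apply_eq_iteratedDeriv_mul_prod]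
    simp only [Finset.prod_const, Finset.card_univ, Fintype.card_fin, smul_eq_mul, signedDeriv]
    rw [← mul_assoc, ← mul_pow]
    ring
  simp only [hpow, add_sub_cancel, smul_eq_mul] at key
  rw [key]
  congr 1
  · refine Finset.sum_congr rfl fun k _ => ?_
    ring
  · rw [taylorRemainder, mul_left_comm]
    refine congrArg (fun u => (n.factorial : ℝ)⁻¹ * u) (Eq.trans ?_
      (intervalIntegral.integral_const_mul _ _))
    refine intervalIntegral.integral_congr fun t _ => ?_
    ring

lemma continuousOn_remainder_integrand (hg : CompletelyMonotone g) {a z : ℝ} (ha : 0 < a)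
    (hz : 0 < z) (n : ℕ) :
    ContinuousOn (fun t : ℝ => (1 - t) ^ n * signedDeriv g (n + 1) (a + t * (z - a)))
      (Icc 0 1) := by
  refine ContinuousOn.mul (by fun_prop) fun t ht => ?_
  refine ContinuousAt.continuousWithinAt (ContinuousAt.comp
    (f := fun t : ℝ => a + t * (z - a)) (g := signedDeriv g (n + 1)) ?_ (by fun_prop))
  exact (hg.hasDerivAt_signedDeriv _ (segment_pos ha hz ht)).continuousAt

lemma taylorRemainder_nonneg (hg : CompletelyMonotone g) {a z : ℝ} (ha : 0 < a) (hz : 0 < z)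
    (n : ℕ) : 0 ≤ taylorRemainder g a n z := by
  refine mul_nonneg (by positivity) (intervalIntegral.integral_nonneg zero_le_one fun t ht => ?_)
  exact mul_nonneg (pow_nonneg (by linarith [ht.2]) _)
    (hg.signedDeriv_nonneg _ (segment_pos ha hz ht))

lemma taylorRemainder_anti (hg : CompletelyMonotone g) {a z w : ℝ} (ha : 0 < a) (hw : 0 < w)
    (hwz : w ≤ z) (n : ℕ) : taylorRemainder g a n z ≤ taylorRemainder g a n w := by
  have hz := hw.trans_le hwz
  refine mul_le_mul_of_nonneg_left ?_ (by positivity)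
  refine intervalIntegral.integral_mono_on zero_le_one ?_ ?_ fun t ht => ?_
  · exact (hg.continuousOn_remainder_integrand ha hz n).intervalIntegrable_of_Icc zero_le_one
  · exact (hg.continuousOn_remainder_integrand ha hw n).intervalIntegrable_of_Icc zero_le_one
  · refine mul_le_mul_of_nonneg_left ?_ (pow_nonneg (by linarith [ht.2]) _)
    refine hg.antitoneOn_signedDeriv _ (segment_pos ha hw ht) (segment_pos ha hz ht) ?_
    nlinarith [ht.1]

lemma taylor_sum_le (hg : CompletelyMonotone g) {a z : ℝ} (hz : 0 < z) (hza : z ≤ a) (n : ℕ) :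
    ∑ k ∈ Finset.range (n + 1), (a - z) ^ k / k.factorial * signedDeriv g k a ≤ g z := by
  have ha := hz.trans_le hza
  rw [hg.taylor_formula ha hz n]
  exact le_add_of_nonneg_right (mul_nonneg (pow_nonneg (by linarith) _)
    (hg.taylorRemainder_nonneg ha hz n))

/-- The rescaled remainder decreases in `z`, so its value at `z` is at most that at `z/2`. There,
positivity of the Taylor terms bounds the full remainder by `g (z/2)`; the ratio `q < 1` of the
distances to `a` then gives geometric decay. -/
lemma tendsto_taylor_sum (hg : CompletelyMonotone g) {a z : ℝ} (hz : 0 < z) (hza : z < a) :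
    Tendsto (fun n => ∑ k ∈ Finset.range (n + 1), (a - z) ^ k / k.factorial * signedDeriv g k a)
      atTop (𝓝 (g z)) := by
  have ha := hz.trans hza
  have hw : 0 < z / 2 := by positivity
  have hd : 0 < a - z / 2 := by linarith
  set q := (a - z) / (a - z / 2)
  have hq0 : 0 ≤ q := div_nonneg (by linarith) hd.le
  have hq1 : q < 1 := (div_lt_one hd).2 (by linarith)
  have hgw : ∀ n, (a - z / 2) ^ (n + 1) * taylorRemainder g a n (z / 2) ≤ g (z / 2) := by
    intro n
    rw [hg.taylor_formula ha hw n]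
    refine le_add_of_nonneg_left (Finset.sum_nonneg fun k _ => ?_)
    exact mul_nonneg (by positivity) (hg.signedDeriv_nonneg k ha)
  have hR : Tendsto (fun n => (a - z) ^ (n + 1) * taylorRemainder g a n z) atTop (𝓝 0) := by
    refine squeeze_zero (g := fun n => q ^ (n + 1) * g (z / 2)) (fun n => ?_) (fun n => ?_) ?_
    · exact mul_nonneg (pow_nonneg (by linarith) _) (hg.taylorRemainder_nonneg ha hz n)
    · calc (a - z) ^ (n + 1) * taylorRemainder g a n z
          ≤ (a - z) ^ (n + 1) * taylorRemainder g a n (z / 2) :=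
            mul_le_mul_of_nonneg_left (hg.taylorRemainder_anti ha hw (by linarith) n)
              (pow_nonneg (by linarith) _)
        _ = q ^ (n + 1) * ((a - z / 2) ^ (n + 1) * taylorRemainder g a n (z / 2)) := by
            rw [← mul_assoc, ← mul_pow, div_mul_cancel₀ _ hd.ne']
        _ ≤ _ := mul_le_mul_of_nonneg_left (hgw n) (pow_nonneg hq0 _)
    · simpa using ((tendsto_pow_atTop_nhds_zero_of_lt_one hq0 hq1).comp
        (tendsto_add_atTop_nat 1)).mul_const (g (z / 2))
  have := (tendsto_const_nhds (x := g z)).sub hR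
  rw [sub_zero] at this
  refine this.congr fun n => ?_
  rw [hg.taylor_formula ha hz n]
  ring

lemma le_of_tendsto_zero (hg : CompletelyMonotone g) {c : ℝ} (h0 : HasDerivLimitAtZero 0 g c)
    {z : ℝ} (hz : 0 < z) : g z ≤ c := by
  have h0' : Tendsto g (𝓝[>] 0) (𝓝 c) := by simpa [HasDerivLimitAtZero] using h0
  refine ge_of_tendsto h0' ?_
  filter_upwards [Ioo_mem_nhdsGT hz] with w hw
  have := hg.antitoneOn_signedDeriv 0 (mem_Ioi.2 hw.1) (mem_Ioi.2 hz) hw.2.le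
  simpa [signedDeriv] using this

/-- Let `z → 0+` in a fixed partial sum. This bounds the masses of the discrete measures used for
Bernstein's theorem. -/
lemma taylor_sum_zero_le (hg : CompletelyMonotone g) {c : ℝ} (h0 : HasDerivLimitAtZero 0 g c)
    {a : ℝ} (ha : 0 < a) (n : ℕ) :
    ∑ k ∈ Finset.range (n + 1), a ^ k / k.factorial * signedDeriv g k a ≤ c := by
  have hlim : Tendsto (fun z : ℝ => ∑ k ∈ Finset.range (n + 1),
      (a - z) ^ k / k.factorial * signedDeriv g k a) (𝓝[>] 0)
      (𝓝 (∑ k ∈ Finset.range (n + 1), (a - 0) ^ k / k.factorial * signedDeriv g k a)) := by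
    have : Continuous (fun z : ℝ => ∑ k ∈ Finset.range (n + 1),
      (a - z) ^ k / k.factorial * signedDeriv g k a) := by fun_prop
    exact (this.tendsto 0).mono_left nhdsWithin_le_nhds
  rw [sub_zero] at hlim
  refine le_of_tendsto hlim ?_
  filter_upwards [Ioo_mem_nhdsGT ha] with z hz
  exact (hg.taylor_sum_le hz.1 hz.2.le n).trans (hg.le_of_tendsto_zero h0 hz.1)

end CompletelyMonotone

/-- `G` is the function of power moments of a finite measure on the unit interval whose mass is at
most `c`. -/
def IsMomentFunction (c : ℝ≥0) (G : ℝ → ℝ) : Prop :=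
  ∃ μ : FiniteMeasure unitInterval, μ.mass ≤ c ∧
    ∀ z : ℝ, 0 < z → ∫ x, (x : ℝ) ^ z ∂(μ : Measure unitInterval) = G z

/-- Measures of mass at most `c` on a compact space form a weakly compact set, so an ultrafilter
limit exists; `x ↦ x^z` is a continuous test function because `z > 0`. -/
lemma IsMomentFunction.of_tendsto {c : ℝ≥0} {F : ℕ → ℝ → ℝ} {G : ℝ → ℝ}
    (hF : ∀ n, IsMomentFunction c (F n))
    (hlim : ∀ z, 0 < z → Tendsto (fun n => F n z) atTop (𝓝 (G z))) : IsMomentFunction c G := by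
  choose μ hμ hμF using hF
  obtain ⟨P, hP, hle⟩ := (isCompact_setOfPred_finiteMeasure_le_of_compactSpace unitInterval c
    ).ultrafilter_le_nhds ((hyperfilter ℕ).map μ) (by simp [hμ])
  refine ⟨P, hP, fun z hz => ?_⟩
  let f : BoundedContinuousFunction unitInterval ℝ := BoundedContinuousFunction.mkOfCompact
    ⟨fun x => (x : ℝ) ^ z, continuous_subtype_val.rpow_const fun _ => Or.inr hz.le⟩
  have h1 : Tendsto μ (hyperfilter ℕ : Filter ℕ) (𝓝 P) := hle
  have h2 := FiniteMeasure.tendsto_iff_forall_integral_tendsto.1 h1 f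
  refine tendsto_nhds_unique h2 ?_
  refine Tendsto.congr (fun n => ((hμF n z hz).symm)) ((hlim z hz).mono_left ?_)
  rw [← Nat.cofinite_eq_atTop]
  exact hyperfilter_le_cofinite

lemma isMomentFunction_sum {ι : Type*} (s : Finset ι) (w : ι → ℝ) (hw : ∀ i, 0 ≤ w i)
    (p : ι → unitInterval) {c : ℝ≥0} (hc : ∑ i ∈ s, w i ≤ c) :
    IsMomentFunction c fun z => ∑ i ∈ s, w i * (p i : ℝ) ^ z := by
  let μ : Measure unitInterval := ∑ i ∈ s, ENNReal.ofReal (w i) • Measure.dirac (p i)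
  have hμ : μ univ = ENNReal.ofReal (∑ i ∈ s, w i) := by
    simp [μ, ENNReal.ofReal_sum_of_nonneg fun i _ => hw i]
  have hfin : IsFiniteMeasure μ := ⟨by rw [hμ]; exact ENNReal.ofReal_lt_top⟩
  let μ' : FiniteMeasure unitInterval := ⟨μ, hfin⟩
  refine ⟨μ', ?_, fun z hz => ?_⟩
  · rw [← ENNReal.coe_le_coe, FiniteMeasure.ennreal_mass]
    change μ univ ≤ c
    rw [hμ]
    exact ENNReal.ofReal_le_iff_le_toReal ENNReal.coe_ne_top |>.2 (by simpa using hc)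
  · have hcont : Continuous fun x : unitInterval => (x : ℝ) ^ z :=
      continuous_subtype_val.rpow_const fun _ => Or.inr hz.le
    change ∫ x, (x : ℝ) ^ z ∂(∑ i ∈ s, ENNReal.ofReal (w i) • Measure.dirac (p i)) = _
    rw [integral_finsetSum_measure]
    · refine Finset.sum_congr rfl fun i _ => ?_
      rw [integral_smul_measure, integral_dirac, ENNReal.toReal_ofReal (hw i), smul_eq_mul]
    · intro i _
      refine Integrable.smul_measure ?_ ENNReal.ofReal_ne_top
      exact integrable_dirac (by simp)

/-- **Bernstein's theorem** in terms of power moments on the unit interval. -/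
lemma CompletelyMonotone.isMomentFunction {g : ℝ → ℝ} (hg : CompletelyMonotone g) {c : ℝ≥0}
    (h0 : HasDerivLimitAtZero 0 g c) : IsMomentFunction c g := by
  let a : ℕ → ℝ := fun m => m + 1
  have ha : ∀ m, 0 < a m := fun m => by positivity
  -- Expanding `g` about `a` at the point `a(1 - e^{-z/a})` gives `∑ (aᵏ/k!) (-1)ᵏ g⁽ᵏ⁾(a)
  -- (e^{-k/a})^z`, the moments of a discrete measure on `[0, 1]`. The point tends to `z` as `a →
  -- ∞`.
  refine IsMomentFunction.of_tendsto (F := fun m z => g (a m * (1 - Real.exp (-(z / a m))))) ?_ ?_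
  · intro m
    refine IsMomentFunction.of_tendsto (F := fun n z => ∑ k ∈ Finset.range (n + 1),
      (a m ^ k / k.factorial * signedDeriv g k (a m)) * (Real.exp (-(k / a m))) ^ z) ?_ ?_
    · intro n
      refine isMomentFunction_sum (Finset.range (n + 1))
        (fun k : ℕ => a m ^ k / k.factorial * signedDeriv g k (a m)) (fun k => ?_)
        (fun k : ℕ => ⟨Real.exp (-(k / a m)), (Real.exp_pos _).le, ?_⟩) ?_
      · exact mul_nonneg (by have := ha m; positivity) (hg.signedDeriv_nonneg k (ha m))
      · refine Real.exp_le_one_iff.2 (neg_nonpos.2 ?_)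
        have := ha m
        positivity
      · exact hg.taylor_sum_zero_le h0 (ha m) n
    · intro z hz
      have hq : 0 < z / a m := div_pos hz (ha m)
      have he : Real.exp (-(z / a m)) < 1 := Real.exp_lt_one_iff.2 (by linarith)
      refine (hg.tendsto_taylor_sum (a := a m) (mul_pos (ha m) (by linarith)) ?_).congr fun n => ?_
      · nlinarith [ha m, Real.exp_pos (-(z / a m))]
      · refine Finset.sum_congr rfl fun k _ => ?_
        have h1 : a m - a m * (1 - Real.exp (-(z / a m))) = a m * Real.exp (-(z / a m)) := by ring
        rw [h1, mul_pow, ← Real.exp_nat_mul, ← Real.exp_mul]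
        have h2 : (k : ℝ) * -(z / a m) = -(k / a m) * z := by ring
        rw [h2]
        ring
  · intro z hz
    refine Tendsto.comp (y := 𝓝 z) (hg.contDiffAt hz).continuousAt ?_
    have hb : Tendsto (fun m : ℕ => (a m)⁻¹) atTop (𝓝[>] 0) := by
      refine tendsto_inv_atTop_nhdsGT_zero.comp ?_
      exact tendsto_natCast_atTop_atTop.atTop_add tendsto_const_nhds
    have hder : HasDerivAt (fun u : ℝ => 1 - Real.exp (-(z * u))) z 0 := by
      have := (((hasDerivAt_id (0 : ℝ)).const_mul z).neg.exp).const_sub 1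
      simpa using this
    have hsl := hder.tendsto_slope_zero_right.comp hb
    refine hsl.congr fun m => ?_
    simp [div_eq_mul_inv]

/-- **Bernstein's theorem**: a completely monotone function with finite limit at `0+` is the
Laplace transform of a finite measure. -/
theorem CompletelyMonotone.exists_isPosLaplace {g : ℝ → ℝ} (hg : CompletelyMonotone g) {c : ℝ≥0}
    (h0 : HasDerivLimitAtZero 0 g c) : ∃ ν, IsPosLaplace g ν := by
  obtain ⟨μ, -, hμ⟩ := hg.isMomentFunction h0
  let φ : unitInterval → ℝ≥0 := fun x => (-Real.log (x : ℝ)).toNNReal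
  have hφ : Measurable φ := by fun_prop
  -- An atom at `0` corresponds to `s = ∞` and contributes `0^z = 0`. It must be removed, since
  -- `Real.log 0 = 0` would send it to `s = 0`.
  let S : Set unitInterval := {0}ᶜ
  have hS : MeasurableSet S := (measurableSet_singleton _).compl
  let ν : Measure ℝ≥0 := ((μ : Measure unitInterval).restrict S).map φ
  have hν : IsFiniteMeasure ν := by dsimp only [ν]; infer_instance
  refine ⟨⟨ν, hν⟩, fun z hz => ?_⟩
  change g z = ∫ s, Real.exp (-(z * (s : ℝ))) ∂(((μ : Measure unitInterval).restrict S).map φ)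
  rw [integral_map hφ.aemeasurable (by fun_prop), ← hμ z hz,
    ← setIntegral_eq_integral_of_forall_compl_eq_zero (s := S)]
  · refine setIntegral_congr_fun hS fun x hx => ?_
    have hx0 : 0 < (x : ℝ) := lt_of_le_of_ne x.2.1 fun h => hx (Subtype.ext h.symm)
    have hlog : 0 ≤ -Real.log (x : ℝ) := by linarith [Real.log_nonpos x.2.1 x.2.2]
    simp only [φ, Real.coe_toNNReal _ hlog]
    rw [Real.rpow_def_of_pos hx0]
    congr 1
    ring
  · intro x hx
    have : x = 0 := by simpa [S] using hx
    simp [this, Real.zero_rpow hz.ne']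

/-! ### Uniqueness of Laplace transforms -/

/-- The Laplace transform on the real axis of a measure on `[0, ∞)`. -/
def laplace (μ : Measure ℝ≥0) (z : ℝ) : ℝ := ∫ s, Real.exp (-(z * (s : ℝ))) ∂μ

lemma integrable_exp_neg (μ : Measure ℝ≥0) [IsFiniteMeasure μ] {z : ℝ} (hz : 0 ≤ z) :
    Integrable (fun s : ℝ≥0 => Real.exp (-(z * (s : ℝ)))) μ := by
  refine Integrable.of_bound (by fun_prop) 1 (Eventually.of_forall fun s => ?_)
  rw [Real.norm_eq_abs, Real.abs_exp, Real.exp_le_one_iff]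
  have := mul_nonneg hz s.2
  simpa using this

lemma laplace_zero (μ : Measure ℝ≥0) : laplace μ 0 = μ.real univ := by
  simp [laplace]

lemma tendsto_laplace_zero (μ : Measure ℝ≥0) [IsFiniteMeasure μ] :
    Tendsto (laplace μ) (𝓝[>] 0) (𝓝 (μ.real univ)) := by
  rw [← laplace_zero]
  refine tendsto_integral_filter_of_dominated_convergence (fun _ => 1) ?_ ?_
    (integrable_const _) ?_
  · exact Eventually.of_forall fun z => by fun_prop
  · filter_upwards [self_mem_nhdsWithin] with z hz
    refine Eventually.of_forall fun s => ?_
    rw [Real.norm_eq_abs, Real.abs_exp, Real.exp_le_one_iff]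
    have := mul_nonneg (le_of_lt hz) s.2
    simpa using this
  · refine Eventually.of_forall fun s => ?_
    have : Continuous fun z : ℝ => Real.exp (-(z * (s : ℝ))) := by fun_prop
    exact (this.tendsto 0).mono_left nhdsWithin_le_nhds

/-- A finite measure on `[0, ∞)` is determined by its Laplace transform. -/
theorem measure_eq_of_laplace_eq {μ ν : Measure ℝ≥0} [IsFiniteMeasure μ] [IsFiniteMeasure ν]
    (h : ∀ z, 0 < z → laplace μ z = laplace ν z) : μ = ν := by
  have h0 : ∀ z, 0 ≤ z → laplace μ z = laplace ν z := by
    intro z hz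
    rcases hz.eq_or_lt with rfl | hz
    · rw [laplace_zero, laplace_zero]
      refine tendsto_nhds_unique ((tendsto_laplace_zero μ).congr' ?_) (tendsto_laplace_zero ν)
      filter_upwards [self_mem_nhdsWithin] with z hz using h z hz
    · exact h z hz
  let f : BoundedContinuousFunction ℝ≥0 ℝ := BoundedContinuousFunction.ofNormedAddCommGroup
    (fun s => Real.exp (-(s : ℝ))) (by fun_prop) 1 (fun s => by simp)
  -- Polynomials in `e^{-s}` separate points, and their integrals are combinations of Laplace
  -- transforms at the integers `n ≥ 0`; the constant term is why `z = 0` was included above.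
  let A : StarSubalgebra ℝ (BoundedContinuousFunction ℝ≥0 ℝ) :=
    { (Polynomial.aeval (R := ℝ) f).range with
      star_mem' := fun {a} ha => by
        have : star a = a := by ext; simp
        rwa [this] }
  have hfA : f ∈ A := ⟨Polynomial.X, by simp⟩
  refine ext_of_forall_mem_subalgebra_integral_eq_of_polish (𝕜 := ℝ) (A := A) ?_ ?_
  · intro x y hxy
    refine ⟨f, ?_, ?_⟩
    · exact ⟨BoundedContinuousFunction.toContinuousMap f, ⟨f, hfA, rfl⟩, rfl⟩
    · simpa [f] using hxy
  · rintro _ ⟨p, rfl⟩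
    change ∫ x, (Polynomial.aeval f p) x ∂μ = ∫ x, (Polynomial.aeval f p) x ∂ν
    induction p using Polynomial.induction_on' with
    | add p q hp hq =>
      simp only [map_add, BoundedContinuousFunction.add_apply]
      rw [integral_add, integral_add, hp, hq] <;>
        exact BoundedContinuousFunction.integrable _ _
    | monomial n a =>
      have : ∀ x, (Polynomial.aeval f (Polynomial.monomial n a)) x =
          a * Real.exp (-((n : ℝ) * (x : ℝ))) := by
        intro x
        simp only [Polynomial.aeval_monomial, BoundedContinuousFunction.mul_apply,
          BoundedContinuousFunction.pow_apply]
        congr 1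
        change Real.exp (-(x : ℝ)) ^ n = _
        rw [← Real.exp_nat_mul]
        congr 1
        ring
      simp only [this]
      rw [integral_const_mul, integral_const_mul]
      exact congrArg _ (h0 n (Nat.cast_nonneg n))

lemma IsPosLaplace.laplace_eq {g : ℝ → ℝ} {ν : FiniteMeasure ℝ≥0} (h : IsPosLaplace g ν) {z : ℝ}
    (hz : 0 < z) : laplace (ν : Measure ℝ≥0) z = g z := (h z hz).symm

lemma IsPosLaplace.bernsteinMeasure_eq {g : ℝ → ℝ} {ν : FiniteMeasure ℝ≥0}
    (h : IsPosLaplace g ν) : bernsteinMeasure g = ν := by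
  have hex : ∃ ν, IsPosLaplace g ν := ⟨ν, h⟩
  rw [bernsteinMeasure, dif_pos hex]
  refine Subtype.ext (measure_eq_of_laplace_eq (μ := (hex.choose : Measure ℝ≥0))
    (ν := (ν : Measure ℝ≥0)) fun z hz => ?_)
  exact (hex.choose_spec.laplace_eq hz).trans (h.laplace_eq hz).symm

/-! ### Linear relations between Laplace transforms -/

section

variable {ι E : Type*} [Fintype ι] [NormedAddCommGroup E]

lemma integral_sum_ofReal_smul [NormedSpace ℝ E] (c : ι → ℝ) (m : ι → Measure ℝ≥0) {F : ℝ≥0 → E}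
    (hF : ∀ i, Integrable F (m i)) :
    ∫ s, F s ∂(∑ i, ENNReal.ofReal (c i) • m i) = ∑ i, (max (c i) 0) • ∫ s, F s ∂(m i) := by
  rw [integral_finsetSum_measure fun i _ => (hF i).smul_measure ENNReal.ofReal_ne_top]
  refine Finset.sum_congr rfl fun i _ => ?_
  rw [integral_smul_measure, ENNReal.toReal_ofReal']

lemma isFiniteMeasure_sum_ofReal_smul (c : ι → ℝ) (m : ι → Measure ℝ≥0)
    [∀ i, IsFiniteMeasure (m i)] : IsFiniteMeasure (∑ i, ENNReal.ofReal (c i) • m i) := by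
  have : ∀ i, IsFiniteMeasure (ENNReal.ofReal (c i) • m i) :=
    fun i => Measure.smul_finite _ ENNReal.ofReal_ne_top
  infer_instance

/-- Moving the negative coefficients to the other side yields two positive measures with equal
Laplace transforms, hence equal measures. -/
lemma sum_real_smul_integral_eq_zero [NormedSpace ℝ E] (c : ι → ℝ) (m : ι → Measure ℝ≥0)
    [∀ i, IsFiniteMeasure (m i)] (h : ∀ z, 0 < z → ∑ i, c i * laplace (m i) z = 0)
    {F : ℝ≥0 → E} (hF : ∀ i, Integrable F (m i)) : ∑ i, c i • ∫ s, F s ∂(m i) = 0 := by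
  have hc : ∀ x : ℝ, x = max x 0 - max (-x) 0 := fun x => by
    rcases le_total x 0 with h | h
    · rw [max_eq_right h, max_eq_left (neg_nonneg.2 h)]; ring
    · rw [max_eq_left h, max_eq_right (neg_nonpos.2 h)]; ring
  have := isFiniteMeasure_sum_ofReal_smul c m
  have := isFiniteMeasure_sum_ofReal_smul (fun i => -c i) m
  have key : ∑ i, ENNReal.ofReal (c i) • m i = ∑ i, ENNReal.ofReal (-c i) • m i := by
    refine measure_eq_of_laplace_eq fun z hz => ?_
    rw [laplace, laplace, integral_sum_ofReal_smul c m fun i => integrable_exp_neg _ hz.le,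
      integral_sum_ofReal_smul (fun i => -c i) m fun i => integrable_exp_neg _ hz.le,
      ← sub_eq_zero, ← Finset.sum_sub_distrib]
    refine (Finset.sum_congr rfl fun i _ => ?_).trans (h z hz)
    rw [← sub_smul, ← hc, smul_eq_mul, laplace]
  have h1 := integral_sum_ofReal_smul c m hF
  rw [key, integral_sum_ofReal_smul (fun i => -c i) m hF, ← sub_eq_zero,
    ← Finset.sum_sub_distrib] at h1
  rw [← neg_eq_zero, ← h1, ← Finset.sum_neg_distrib]
  refine Finset.sum_congr rfl fun i _ => ?_
  rw [← sub_smul, ← neg_smul]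
  congr 1
  linarith [hc (c i)]

/-- A linear relation between Laplace transforms carries over to all integrals. -/
lemma sum_smul_integral_eq_zero [NormedSpace ℂ E] (c : ι → ℂ) (m : ι → Measure ℝ≥0)
    [∀ i, IsFiniteMeasure (m i)] (h : ∀ z : ℝ, 0 < z → ∑ i, c i * (laplace (m i) z : ℂ) = 0)
    {F : ℝ≥0 → E} (hF : ∀ i, Integrable F (m i)) : ∑ i, c i • ∫ s, F s ∂(m i) = 0 := by
  have hre := sum_real_smul_integral_eq_zero (fun i => (c i).re) m (fun z hz => by
    simpa using congrArg Complex.re (h z hz)) hF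
  have him := sum_real_smul_integral_eq_zero (fun i => (c i).im) m (fun z hz => by
    simpa using congrArg Complex.im (h z hz)) hF
  have hsplit : ∀ i, c i • ∫ s, F s ∂(m i) = (c i).re • (∫ s, F s ∂(m i)) +
      Complex.I • ((c i).im • ∫ s, F s ∂(m i)) := by
    intro i
    nth_rewrite 1 [← Complex.re_add_im (c i)]
    rw [add_smul, mul_comm, mul_smul, Complex.coe_smul, Complex.coe_smul]
  simp only [hsplit]
  rw [Finset.sum_add_distrib, ← Finset.smul_sum, hre, him, smul_zero, add_zero]

end

/-! ### Moments -/

namespace IsPosLaplace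

variable {g : ℝ → ℝ} {ν : FiniteMeasure ℝ≥0}

/-- Near `z > 0`, `g` is the moment generating function of `-s`, and `z` is interior to its domain,
so it may be differentiated under the integral. -/
lemma signedDeriv_eq (h : IsPosLaplace g ν) (k : ℕ) {z : ℝ} (hz : 0 < z) :
    CompletelyMonotone.signedDeriv g k z =
      ∫ s, (s : ℝ) ^ k * Real.exp (-(z * (s : ℝ))) ∂(ν : Measure ℝ≥0) := by
  let X : ℝ≥0 → ℝ := fun s => -(s : ℝ)
  have hset : Ioi 0 ⊆ ProbabilityTheory.integrableExpSet X (ν : Measure ℝ≥0) := by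
    intro w hw
    have := integrable_exp_neg (ν : Measure ℝ≥0) (le_of_lt hw)
    simpa [ProbabilityTheory.integrableExpSet, X] using this
  have hint : z ∈ interior (ProbabilityTheory.integrableExpSet X (ν : Measure ℝ≥0)) :=
    interior_mono hset (by rwa [interior_Ioi])
  have heq : g =ᶠ[𝓝 z] ProbabilityTheory.mgf X (ν : Measure ℝ≥0) := by
    filter_upwards [Ioi_mem_nhds hz] with w hw
    rw [h w hw, ProbabilityTheory.mgf]
    simp [X]
  rw [CompletelyMonotone.signedDeriv, heq.iteratedDeriv_eq, ProbabilityTheory.iteratedDeriv_mgf hint,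
    ← integral_const_mul]
  refine integral_congr_ae (Eventually.of_forall fun s => ?_)
  simp only [X]
  rw [← mul_assoc, ← mul_pow]
  simp

lemma integrable_pow_mul_exp (k : ℕ) {z : ℝ} (hz : 0 < z) :
    Integrable (fun s : ℝ≥0 => (s : ℝ) ^ k * Real.exp (-(z * (s : ℝ)))) (ν : Measure ℝ≥0) := by
  refine Integrable.of_bound (by fun_prop) (k.factorial / z ^ k) (Eventually.of_forall fun s => ?_)
  have h := Real.pow_div_factorial_le_exp (z * s) (by positivity) k
  rw [div_le_iff₀ (by positivity), mul_pow] at h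
  rw [Real.norm_eq_abs, abs_of_nonneg (by positivity), le_div_iff₀ (by positivity), Real.exp_neg,
    ← div_eq_mul_inv, div_mul_eq_mul_div, div_le_iff₀ (Real.exp_pos _)]
  linarith

/-- The moments of the representing measure are the derivatives at `0`. -/
lemma moment (h : IsPosLaplace g ν) {k : ℕ} {c : ℝ} (hc : HasDerivLimitAtZero k g c) :
    Integrable (fun s : ℝ≥0 => (s : ℝ) ^ k) (ν : Measure ℝ≥0) ∧
      ∫ s, (s : ℝ) ^ k ∂(ν : Measure ℝ≥0) = (-1) ^ k * c := by
  have hlim : Tendsto (fun z => ∫ s, (s : ℝ) ^ k * Real.exp (-(z * (s : ℝ))) ∂(ν : Measure ℝ≥0))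
      (𝓝[>] 0) (𝓝 ((-1) ^ k * c)) := by
    refine (Tendsto.const_mul ((-1) ^ k) hc).congr' ?_
    filter_upwards [self_mem_nhdsWithin] with z hz using h.signedDeriv_eq k hz
  have hpt : ∀ s : ℝ≥0, Tendsto (fun z : ℝ => (s : ℝ) ^ k * Real.exp (-(z * (s : ℝ)))) (𝓝[>] 0)
      (𝓝 ((s : ℝ) ^ k)) := by
    intro s
    have : Continuous fun z : ℝ => (s : ℝ) ^ k * Real.exp (-(z * (s : ℝ))) := by fun_prop
    simpa using (this.tendsto 0).mono_left (nhdsWithin_le_nhds (s := Ioi 0))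
  have hint : Integrable (fun s : ℝ≥0 => (s : ℝ) ^ k) (ν : Measure ℝ≥0) := by
    have hz : Tendsto (fun n : ℕ => 1 / ((n : ℝ) + 1)) atTop (𝓝[>] 0) :=
      tendsto_nhdsWithin_iff.2 ⟨tendsto_one_div_add_atTop_nhds_zero_nat,
        Eventually.of_forall fun n => by simp only [mem_Ioi]; positivity⟩
    refine ⟨by fun_prop, ?_⟩
    rw [hasFiniteIntegral_iff_ofReal (Eventually.of_forall fun s => by positivity)]
    -- Fatou's lemma along `z = 1/(n+1)` gives integrability of `s^k`, which then serves as the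
    -- dominating function.
    have hF := lintegral_liminf_le (μ := (ν : Measure ℝ≥0)) (u := atTop)
      (f := fun (n : ℕ) (s : ℝ≥0) => ENNReal.ofReal
        ((s : ℝ) ^ k * Real.exp (-(1 / ((n : ℝ) + 1) * (s : ℝ)))))
      (fun n => by fun_prop)
    have hL : ∀ s : ℝ≥0, liminf (fun n : ℕ =>
        ENNReal.ofReal ((s : ℝ) ^ k * Real.exp (-(1 / ((n : ℝ) + 1) * (s : ℝ))))) atTop =
        ENNReal.ofReal ((s : ℝ) ^ k) := fun s =>
      ((ENNReal.continuous_ofReal.tendsto _).comp ((hpt s).comp hz)).liminf_eq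
    simp only [hL] at hF
    have hR : Tendsto (fun n : ℕ => ∫⁻ s, ENNReal.ofReal ((s : ℝ) ^ k *
        Real.exp (-(1 / ((n : ℝ) + 1) * (s : ℝ)))) ∂(ν : Measure ℝ≥0)) atTop
        (𝓝 (ENNReal.ofReal ((-1) ^ k * c))) := by
      refine ((ENNReal.continuous_ofReal.tendsto _).comp (hlim.comp hz)).congr fun n => ?_
      exact ofReal_integral_eq_lintegral_ofReal (integrable_pow_mul_exp k (by positivity))
        (Eventually.of_forall fun s => by positivity)
    rw [hR.liminf_eq] at hF
    exact hF.trans_lt ENNReal.ofReal_lt_top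
  refine ⟨hint, tendsto_nhds_unique ?_ hlim⟩
  refine tendsto_integral_filter_of_dominated_convergence (fun s : ℝ≥0 => (s : ℝ) ^ k) ?_ ?_ hint
    (Eventually.of_forall hpt)
  · exact Eventually.of_forall fun z => by fun_prop
  · filter_upwards [self_mem_nhdsWithin] with z hz
    refine Eventually.of_forall fun s => ?_
    rw [Real.norm_eq_abs, abs_of_nonneg (by positivity)]
    refine mul_le_of_le_one_right (by positivity) (Real.exp_le_one_iff.2 ?_)
    have := mul_nonneg (le_of_lt hz) s.2
    simpa using this

end IsPosLaplace

/-! ### Scaled convolution powers -/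

/-- The law of `r (s₁ + ⋯ + sₙ)` for independent `s₁, …, sₙ` with law `ν`. -/
def scaledSum (ν : Measure ℝ≥0) (r : ℝ≥0) (n : ℕ) : Measure ℝ≥0 :=
  (Measure.pi fun _ : Fin n => ν).map fun s => r * ∑ i, s i

section

variable (ν : Measure ℝ≥0) [IsProbabilityMeasure ν] (r : ℝ≥0) (n : ℕ)

instance : IsProbabilityMeasure (scaledSum ν r n) :=
  Measure.isProbabilityMeasure_map (by fun_prop)

lemma laplace_scaledSum (z : ℝ) : laplace (scaledSum ν r n) z = laplace ν (r * z) ^ n := by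
  rw [laplace, scaledSum, integral_map (by fun_prop) (by fun_prop)]
  have : ∀ s : Fin n → ℝ≥0, Real.exp (-(z * ((r * ∑ i, s i : ℝ≥0) : ℝ))) =
      ∏ i, Real.exp (-((r * z) * (s i : ℝ))) := by
    intro s
    rw [← Real.exp_sum, Finset.sum_neg_distrib, ← Finset.mul_sum]
    push_cast
    congr 1
    ring
  simp only [this]
  rw [integral_fintype_prod_eq_pow (fun s : ℝ≥0 => Real.exp (-((r * z) * (s : ℝ)))),
    Fintype.card_fin, laplace]

variable {ν}

lemma memLp_scaledSum (h : MemLp (fun s : ℝ≥0 => (s : ℝ)) 2 ν) :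
    MemLp (fun s : ℝ≥0 => (s : ℝ)) 2 (scaledSum ν r n) := by
  rw [scaledSum, memLp_map_measure_iff (by fun_prop) (by fun_prop)]
  have : (fun s : ℝ≥0 => (s : ℝ)) ∘ (fun s : Fin n → ℝ≥0 => r * ∑ i, s i) =
      (r : ℝ) • (fun s : Fin n → ℝ≥0 => ∑ i, (s i : ℝ)) := by
    ext s; simp
  rw [this]
  have hi : ∀ i ∈ Finset.univ, MemLp (fun s : Fin n → ℝ≥0 => (s i : ℝ)) 2
      (Measure.pi fun _ : Fin n => ν) := fun i _ =>
    h.comp_measurePreserving (measurePreserving_eval (fun _ : Fin n => ν) i)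
  exact (memLp_finsetSum _ hi).const_smul (r : ℝ)

lemma integral_scaledSum (h : MemLp (fun s : ℝ≥0 => (s : ℝ)) 2 ν) :
    ∫ s, (s : ℝ) ∂(scaledSum ν r n) = r * (n * ∫ s, (s : ℝ) ∂ν) := by
  rw [scaledSum, integral_map (by fun_prop) (by fun_prop)]
  push_cast
  rw [integral_const_mul, integral_finsetSum]
  · have : ∀ i : Fin n, ∫ s : Fin n → ℝ≥0, (s i : ℝ) ∂(Measure.pi fun _ : Fin n => ν) =
        ∫ s, (s : ℝ) ∂ν := fun i => by
      have hp := measurePreserving_eval (fun _ : Fin n => ν) i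
      conv_rhs => rw [← hp.map_eq]
      rw [integral_map hp.measurable.aemeasurable (by fun_prop)]
    simp [this]
  · intro i _
    exact (h.comp_measurePreserving (measurePreserving_eval (fun _ : Fin n => ν) i)).integrable
      one_le_two

lemma variance_scaledSum (h : MemLp (fun s : ℝ≥0 => (s : ℝ)) 2 ν) :
    ProbabilityTheory.variance (fun s : ℝ≥0 => (s : ℝ)) (scaledSum ν r n) =
      r ^ 2 * (n * ProbabilityTheory.variance (fun s : ℝ≥0 => (s : ℝ)) ν) := by
  rw [scaledSum, ProbabilityTheory.variance_map (by fun_prop) (by fun_prop)]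
  have : (fun s : ℝ≥0 => (s : ℝ)) ∘ (fun s : Fin n → ℝ≥0 => r * ∑ i, s i) =
      fun s => (r : ℝ) * (∑ i : Fin n, fun s : Fin n → ℝ≥0 => (s i : ℝ)) s := by
    ext s; simp
  rw [this, ProbabilityTheory.variance_const_mul,
    ProbabilityTheory.variance_sum_pi (X := fun (_ : Fin n) (s : ℝ≥0) => (s : ℝ)) fun _ => h]
  simp

end

/-- The representing measure of `z ↦ g(tz/n)^n` is a probability measure with mean `t` and variance
`(g''(0) - 1) t² / n`. -/
theorem CompletelyMonotone.bernsteinMeasure_pow {g : ℝ → ℝ} (hg : CompletelyMonotone g) {c : ℝ}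
    (h0 : HasDerivLimitAtZero 0 g 1) (h1 : HasDerivLimitAtZero 1 g (-1))
    (h2 : HasDerivLimitAtZero 2 g c) {n : ℕ} (hn : 1 ≤ n) {t : ℝ≥0} (ht : 0 < t) :
    ∃ μ : FiniteMeasure ℝ≥0, bernsteinMeasure (fun z => g (t * z / n) ^ n) = μ ∧
      IsPosLaplace (fun z => g (t * z / n) ^ n) μ ∧
      IsProbabilityMeasure (μ : Measure ℝ≥0) ∧
      MemLp (fun s : ℝ≥0 => (s : ℝ)) 2 (μ : Measure ℝ≥0) ∧
      ∫ s, (s : ℝ) ∂(μ : Measure ℝ≥0) = t ∧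
      ∫ s, ((s : ℝ) - t) ^ 2 ∂(μ : Measure ℝ≥0) = (c - 1) * ((t : ℝ) ^ 2 / n) := by
  obtain ⟨ν, hν⟩ := hg.exists_isPosLaplace (c := 1) (by simpa using h0)
  have hn0 : (0 : ℝ) < n := by exact_mod_cast hn
  have m0 := hν.moment h0
  have m1 := hν.moment h1
  have m2 := hν.moment h2
  have hprob : IsProbabilityMeasure (ν : Measure ℝ≥0) := by
    constructor
    have := m0.2
    simp only [pow_zero, integral_const, smul_eq_mul, mul_one] at this
    rw [← ENNReal.toReal_eq_one_iff]
    exact this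
  have hmem : MemLp (fun s : ℝ≥0 => (s : ℝ)) 2 (ν : Measure ℝ≥0) :=
    (memLp_two_iff_integrable_sq (by fun_prop)).2 m2.1
  have hmean : ∫ s, (s : ℝ) ∂(ν : Measure ℝ≥0) = 1 := by simpa using m1.2
  have hvar : ProbabilityTheory.variance (fun s : ℝ≥0 => (s : ℝ)) (ν : Measure ℝ≥0) = c - 1 := by
    rw [ProbabilityTheory.variance_eq_sub hmem, hmean]
    have := m2.2
    simp only [Pi.pow_apply]
    rw [this]
    ring
  -- This scale gives mean `n · (t/n) = t` and variance `n (t/n)² (c - 1)`.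
  let r : ℝ≥0 := t / n
  let μ : FiniteMeasure ℝ≥0 := ⟨scaledSum (ν : Measure ℝ≥0) r n, inferInstance⟩
  have hr : (r : ℝ) = t / n := by simp [r]
  have hL : IsPosLaplace (fun z => g (t * z / n) ^ n) μ := by
    intro z hz
    have := laplace_scaledSum (ν : Measure ℝ≥0) r n z
    have hrz : 0 < (r : ℝ) * z := by rw [hr]; have : (0 : ℝ) < t := ht; positivity
    rw [hν.laplace_eq hrz, hr] at this
    rw [div_mul_eq_mul_div] at this
    exact this.symm
  have hm : ∫ s, (s : ℝ) ∂(scaledSum (ν : Measure ℝ≥0) r n) = t := by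
    rw [integral_scaledSum r n hmem, hmean, hr]
    field_simp
  refine ⟨μ, hL.bernsteinMeasure_eq, hL, ?_, memLp_scaledSum r n hmem, hm, ?_⟩
  · exact inferInstanceAs (IsProbabilityMeasure (scaledSum (ν : Measure ℝ≥0) r n))
  · have hv := variance_scaledSum r n hmem
    rw [ProbabilityTheory.variance_eq_integral (by fun_prop), hm, hvar, hr] at hv
    refine hv.trans ?_
    field_simp

/-- The mean absolute deviation is at most the standard deviation. -/
lemma integral_abs_sub_le {μ : FiniteMeasure ℝ≥0} [IsProbabilityMeasure (μ : Measure ℝ≥0)] {t : ℝ≥0}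
    {V : ℝ} (hmem : MemLp (fun s : ℝ≥0 => (s : ℝ)) 2 (μ : Measure ℝ≥0))
    (hV : ∫ s, ((s : ℝ) - t) ^ 2 ∂(μ : Measure ℝ≥0) = V) :
    ∫ s, |(s : ℝ) - t| ∂(μ : Measure ℝ≥0) ≤ √V := by
  have hm : MemLp (fun s : ℝ≥0 => |(s : ℝ) - t|) 2 (μ : Measure ℝ≥0) :=
    (hmem.sub (memLp_const (t : ℝ))).abs
  refine Real.le_sqrt_of_sq_le ?_
  have h0 := ProbabilityTheory.variance_nonneg (fun s : ℝ≥0 => |(s : ℝ) - t|) (μ : Measure ℝ≥0)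
  rw [ProbabilityTheory.variance_eq_sub hm] at h0
  simp only [Pi.pow_apply, sq_abs, hV] at h0
  linarith

/-! ### Orbits of a bounded semigroup -/

namespace BoundedC0Semigroup

variable {X : Type*} [NormedAddCommGroup X] [NormedSpace ℂ X] (T : BoundedC0Semigroup X)

lemma norm_op_le (s : ℝ≥0) : ‖T.op s‖ ≤ T.bound := by
  obtain ⟨C, hC⟩ := T.bounded
  exact le_ciSup (f := fun s => ‖T.op s‖) ⟨C, by rintro _ ⟨s, rfl⟩; exact hC s⟩ s

lemma bound_nonneg : 0 ≤ T.bound := (norm_nonneg _).trans (T.norm_op_le 0)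

lemma norm_op_apply_le (s : ℝ≥0) (x : X) : ‖T.op s x‖ ≤ T.bound * ‖x‖ :=
  (T.op s).le_of_opNorm_le (T.norm_op_le s) x

lemma op_add_apply (s r : ℝ≥0) (x : X) : T.op (s + r) x = T.op s (T.op r x) := by
  rw [T.op_add]; rfl

lemma tendsto_generator (x : T.generator.domain) :
    Tendsto (fun h : ℝ≥0 => ((h : ℝ)⁻¹ : ℂ) • (T.op h x - x)) (𝓝[>] 0) (𝓝 (T.generator x)) :=
  x.2.choose_spec

/-- The orbit of `x`, as a function on the real line. -/
def orbit (x : X) (s : ℝ) : X := T.op s.toNNReal x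

lemma continuous_orbit' (x : X) : Continuous (T.orbit x) :=
  (T.continuous_orbit x).comp continuous_real_toNNReal

lemma orbit_coe (x : X) (s : ℝ≥0) : T.orbit x s = T.op s x := by
  simp [orbit]

lemma norm_orbit_le (x : X) (s : ℝ) : ‖T.orbit x s‖ ≤ T.bound * ‖x‖ :=
  T.norm_op_apply_le _ x

/-- For `r > s` the difference quotient is `T s` applied to the quotient at `0` with step `r - s`.
The mean value inequalities below need only right derivatives. -/
lemma hasDerivWithinAt_orbit (x : T.generator.domain) {s : ℝ} (hs : 0 ≤ s) :
    HasDerivWithinAt (T.orbit x) (T.orbit (T.generator x) s) (Ici s) s := by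
  rw [hasDerivWithinAt_iff_tendsto_slope, Ici_sdiff_left]
  have h1 : Tendsto (fun r : ℝ => (r - s).toNNReal) (𝓝[>] s) (𝓝[>] 0) := by
    refine tendsto_nhdsWithin_iff.2 ⟨?_, ?_⟩
    · have : Continuous fun r : ℝ => (r - s).toNNReal := by fun_prop
      simpa using (this.tendsto s).mono_left (nhdsWithin_le_nhds (s := Ioi s))
    · filter_upwards [self_mem_nhdsWithin] with r hr
      simpa using hr
  have h2 := ((T.op s.toNNReal).continuous.tendsto _).comp ((T.tendsto_generator x).comp h1)
  refine h2.congr' ?_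
  filter_upwards [self_mem_nhdsWithin] with r hr
  have hr' : s < r := hr
  have hadd : r.toNNReal = s.toNNReal + (r - s).toNNReal := by
    rw [← Real.toNNReal_add hs (by linarith)]
    congr 1
    ring
  simp only [Function.comp_apply, slope_def_module, orbit, hadd, op_add_apply]
  rw [map_smul, map_sub, Real.coe_toNNReal _ (by linarith), ← Complex.ofReal_inv, Complex.coe_smul]

lemma norm_orbit_sub_le (x : T.generator.domain) {s r : ℝ} (hs : 0 ≤ s) (hr : 0 ≤ r) :
    ‖T.orbit x s - T.orbit x r‖ ≤ T.bound * ‖T.generator x‖ * |s - r| := by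
  wlog h : r ≤ s generalizing s r
  · rw [norm_sub_rev, abs_sub_comm]
    exact this hr hs (le_of_not_ge h)
  rw [abs_of_nonneg (by linarith)]
  exact norm_image_sub_le_of_norm_deriv_right_le_segment
    (T.continuous_orbit' _).continuousOn
    (fun u hu => T.hasDerivWithinAt_orbit x (hr.trans hu.1))
    (fun u _ => T.norm_orbit_le _ u) s ⟨h, le_rfl⟩

/-- The first order Taylor estimate for the orbit of `x` at `r`. -/
lemma norm_orbit_taylor_le (x : T.generator.domain) (hx : T.generator x ∈ T.generator.domain)
    {s r : ℝ} (hs : 0 ≤ s) (hr : 0 ≤ r) :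
    ‖T.orbit x s - T.orbit x r - (s - r) • T.orbit (T.generator x) r‖ ≤
      T.bound * ‖T.generator ⟨T.generator x, hx⟩‖ * ((s - r) ^ 2 / 2) := by
  set C := T.bound * ‖T.generator ⟨T.generator x, hx⟩‖
  have hC0 : 0 ≤ C := mul_nonneg T.bound_nonneg (norm_nonneg _)
  have hB : ∀ a u : ℝ, HasDerivAt (fun u => C * ((u - a) ^ 2 / 2)) (C * (u - a)) u := by
    intro a u
    have := ((((hasDerivAt_id u).sub_const a).pow 2).div_const 2).const_mul C
    refine this.congr_deriv ?_
    simp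
  have hsc : ∀ a u : ℝ, HasDerivWithinAt (fun u : ℝ => u - a) 1 (Ici u) u := fun a u =>
    ((hasDerivAt_id u).sub_const a).hasDerivWithinAt
  rcases le_total r s with h | h
  · refine image_norm_le_of_norm_deriv_right_le_deriv_boundary
      (f := fun u => T.orbit x u - T.orbit x r - (u - r) • T.orbit (T.generator x) r)
      (f' := fun u => T.orbit (T.generator x) u - T.orbit (T.generator x) r)
      (B := fun u => C * ((u - r) ^ 2 / 2)) (B' := fun u => C * (u - r)) (a := r) (b := s)
      ?_ ?_ ?_ (hB r) ?_ ⟨h, le_rfl⟩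
    · have := T.continuous_orbit' (x : X)
      fun_prop
    · intro u hu
      have := ((T.hasDerivWithinAt_orbit x (hr.trans hu.1)).sub_const (T.orbit x r)).sub
        ((hsc r u).smul_const (T.orbit (T.generator x) r))
      exact this.congr_deriv (by simp)
    · simp
    · intro u hu
      have := T.norm_orbit_sub_le ⟨T.generator x, hx⟩ (hr.trans hu.1) hr
      rwa [abs_of_nonneg (by linarith [hu.1])] at this
  -- For `s ≤ r` the base point moves upwards from `s` to `r` instead, so right derivatives still
  -- suffice; the first order terms cancel, leaving only the second generator.
  · have key := image_norm_le_of_norm_deriv_right_le_deriv_boundary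
      (f := fun u => T.orbit x s - T.orbit x u - (s - u) • T.orbit (T.generator x) u)
      (f' := fun u => -((s - u) • T.orbit (T.generator ⟨T.generator x, hx⟩) u))
      (B := fun u => C * ((u - s) ^ 2 / 2)) (B' := fun u => C * (u - s)) (a := s) (b := r)
      ?_ ?_ ?_ (hB s) ?_ ⟨h, le_rfl⟩
    · rwa [← neg_sub s r, neg_sq] at key
    · have := T.continuous_orbit' (x : X)
      have := T.continuous_orbit' (T.generator x)
      fun_prop
    · intro u hu
      have hu0 := hs.trans hu.1
      have h1 := (T.hasDerivWithinAt_orbit x hu0).const_sub (T.orbit x s)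
      have h2 : HasDerivWithinAt (fun u : ℝ => s - u) (-1) (Ici u) u :=
        ((hasDerivAt_id u).const_sub s).hasDerivWithinAt
      refine (h1.sub (h2.smul (T.hasDerivWithinAt_orbit ⟨T.generator x, hx⟩ hu0))).congr_deriv ?_
      simp only [neg_smul, one_smul]
      abel
    · simp
    · intro u hu
      rw [norm_neg, norm_smul, Real.norm_eq_abs, abs_sub_comm, abs_of_nonneg (by linarith [hu.1]),
        mul_comm]
      exact mul_le_mul_of_nonneg_right (T.norm_orbit_le _ u) (by linarith [hu.1])

/-! ### Averages of orbits -/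

lemma average_apply (ν : FiniteMeasure ℝ≥0) (x : X) :
    T.average ν x = ∫ s, T.op s x ∂(ν : Measure ℝ≥0) := rfl

lemma norm_average_le (ν : FiniteMeasure ℝ≥0) (x : X) :
    ‖T.average ν x‖ ≤ (ν : Measure ℝ≥0).real univ * (T.bound * ‖x‖) := by
  rw [average_apply, mul_comm]
  exact norm_integral_le_of_norm_le_const (Eventually.of_forall fun s => T.norm_op_apply_le s x)

lemma integrable_op (ν : Measure ℝ≥0) [IsFiniteMeasure ν] (x : X) :
    Integrable (fun s => T.op s x) ν := T.integrable_orbit ⟨ν, inferInstance⟩ x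

variable [CompleteSpace X]

lemma average_sub_op (ν : FiniteMeasure ℝ≥0) [IsProbabilityMeasure (ν : Measure ℝ≥0)] (t : ℝ≥0)
    (x : X) : T.average ν x - T.op t x = ∫ s, (T.op s x - T.op t x) ∂(ν : Measure ℝ≥0) := by
  rw [integral_sub (T.integrable_orbit ν x) (integrable_const _), integral_const]
  simp [average_apply]

/-! ### Error bounds on the domains of the generator and its square -/

section Estimates

variable {T} {μ : FiniteMeasure ℝ≥0} [IsProbabilityMeasure (μ : Measure ℝ≥0)] {t : ℝ≥0} {V : ℝ}

lemma norm_average_sub_op_le (hmem : MemLp (fun s : ℝ≥0 => (s : ℝ)) 2 (μ : Measure ℝ≥0))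
    (hV : ∫ s, ((s : ℝ) - t) ^ 2 ∂(μ : Measure ℝ≥0) = V) (x : T.generator.domain) :
    ‖T.average μ x - T.op t x‖ ≤ T.bound * √V * ‖T.generator x‖ := by
  have hi : Integrable (fun s : ℝ≥0 => |(s : ℝ) - t|) (μ : Measure ℝ≥0) :=
    ((hmem.sub (memLp_const (t : ℝ))).integrable one_le_two).abs
  rw [average_sub_op]
  refine (norm_integral_le_of_norm_le (hi.const_mul (T.bound * ‖T.generator x‖))
    (Eventually.of_forall fun s => ?_)).trans ?_
  · have := T.norm_orbit_sub_le x s.2 t.2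
    simpa only [NNReal.val_eq_coe, orbit_coe] using this
  · rw [integral_const_mul]
    calc _ ≤ T.bound * ‖T.generator x‖ * √V :=
          mul_le_mul_of_nonneg_left (integral_abs_sub_le hmem hV)
            (mul_nonneg T.bound_nonneg (norm_nonneg _))
      _ = _ := by ring

lemma norm_average_sub_op_le_sq (hmem : MemLp (fun s : ℝ≥0 => (s : ℝ)) 2 (μ : Measure ℝ≥0))
    (hmean : ∫ s, (s : ℝ) ∂(μ : Measure ℝ≥0) = t)
    (hV : ∫ s, ((s : ℝ) - t) ^ 2 ∂(μ : Measure ℝ≥0) = V) (x : T.generator.domain)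
    (hx : T.generator x ∈ T.generator.domain) :
    ‖T.average μ x - T.op t x‖ ≤ T.bound * (V / 2) * ‖T.generator ⟨T.generator x, hx⟩‖ := by
  have hi : Integrable (fun s : ℝ≥0 => (s : ℝ) - t) (μ : Measure ℝ≥0) :=
    (hmem.sub (memLp_const (t : ℝ))).integrable one_le_two
  have hi2 : Integrable (fun s : ℝ≥0 => ((s : ℝ) - t) ^ 2) (μ : Measure ℝ≥0) :=
    (hmem.sub (memLp_const (t : ℝ))).integrable_sq
  -- The linear Taylor term integrates to zero because the mean of `μ` is `t`.
  have h0 : ∫ s, ((s : ℝ) - t) • T.op t (T.generator x) ∂(μ : Measure ℝ≥0) = 0 := by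
    rw [integral_smul_const, integral_sub (hmem.integrable one_le_two) (integrable_const _), hmean]
    simp
  have hd : Integrable (fun s => T.op s x - T.op t x) (μ : Measure ℝ≥0) :=
    (T.integrable_orbit μ x).sub (integrable_const _)
  have h1 : T.average μ x - T.op t x = ∫ s, (T.op s x - T.op t x -
      ((s : ℝ) - t) • T.op t (T.generator x)) ∂(μ : Measure ℝ≥0) := by
    rw [integral_sub hd (hi.smul_const _), h0,
      sub_zero, average_sub_op]
  rw [h1]
  refine (norm_integral_le_of_norm_le ((hi2.div_const 2).const_mul
    (T.bound * ‖T.generator ⟨T.generator x, hx⟩‖)) (Eventually.of_forall fun s => ?_)).trans ?_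
  · have := T.norm_orbit_taylor_le x hx s.2 t.2
    simpa only [NNReal.val_eq_coe, orbit_coe] using this
  · rw [integral_const_mul, integral_div, hV]
    exact le_of_eq (by ring)

end Estimates

/-! ### Convolution and averages -/

/-- The semigroup law turns convolution of measures into composition of operators. -/
lemma integral_conv_op (μ ν : Measure ℝ≥0) [IsFiniteMeasure μ] [IsFiniteMeasure ν] (x : X) :
    ∫ s, T.op s x ∂(μ ∗ ν) = ∫ s, T.op s (∫ r, T.op r x ∂ν) ∂μ := by
  rw [integral_conv (T.integrable_op _ x)]
  refine integral_congr_ae (Eventually.of_forall fun s => ?_)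
  simp only [op_add_apply]
  exact (T.op s).integral_comp_comm (T.integrable_op ν x)

lemma average_average (μ ν : FiniteMeasure ℝ≥0) (x : X) :
    T.average μ (T.average ν x) = ∫ s, T.op s x ∂((μ : Measure ℝ≥0) ∗ (ν : Measure ℝ≥0)) :=
  (T.integral_conv_op _ _ x).symm

lemma average_comm (μ ν : FiniteMeasure ℝ≥0) (x : X) :
    T.average μ (T.average ν x) = T.average ν (T.average μ x) := by
  rw [average_average, average_average, Measure.conv_comm]

end BoundedC0Semigroup

lemma laplace_conv (μ ν : Measure ℝ≥0) [IsFiniteMeasure μ] [IsFiniteMeasure ν] {z : ℝ}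
    (hz : 0 ≤ z) : laplace (μ ∗ ν) z = laplace μ z * laplace ν z := by
  rw [laplace, integral_conv (integrable_exp_neg _ hz)]
  have : ∀ s r : ℝ≥0, Real.exp (-(z * ((s + r : ℝ≥0) : ℝ))) =
      Real.exp (-(z * (s : ℝ))) * Real.exp (-(z * (r : ℝ))) := by
    intro s r
    rw [← Real.exp_add]
    push_cast
    congr 1
    ring
  simp only [this, integral_const_mul, integral_mul_const]
  rfl

/-! ### Laplace transforms of signed measures -/

/-- `h` is, on `(0, ∞)`, the Laplace transform of a signed measure on `[0, ∞)` of total variation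
at most `C`. -/
def IsSignedLaplace (h : ℝ → ℝ) (C : ℝ) : Prop :=
  ∃ p q : FiniteMeasure ℝ≥0,
    (∀ z, 0 < z → h z = laplace (p : Measure ℝ≥0) z - laplace (q : Measure ℝ≥0) z) ∧
    (p : Measure ℝ≥0).real univ + (q : Measure ℝ≥0).real univ ≤ C

lemma laplace_add (μ ν : Measure ℝ≥0) [IsFiniteMeasure μ] [IsFiniteMeasure ν] {z : ℝ}
    (hz : 0 ≤ z) : laplace (μ + ν) z = laplace μ z + laplace ν z :=
  integral_add_measure (integrable_exp_neg μ hz) (integrable_exp_neg ν hz)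

lemma real_univ_add (μ ν : Measure ℝ≥0) [IsFiniteMeasure μ] [IsFiniteMeasure ν] :
    (μ + ν).real univ = μ.real univ + ν.real univ := by
  rw [← laplace_zero, laplace_add μ ν le_rfl, laplace_zero, laplace_zero]

lemma real_univ_conv (μ ν : Measure ℝ≥0) [IsFiniteMeasure μ] [IsFiniteMeasure ν] :
    (μ ∗ ν).real univ = μ.real univ * ν.real univ := by
  rw [← laplace_zero, laplace_conv μ ν le_rfl, laplace_zero, laplace_zero]

namespace IsSignedLaplace

variable {h h₁ h₂ : ℝ → ℝ} {C C₁ C₂ : ℝ}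

lemma of_measures {p q : Measure ℝ≥0} [hp : IsFiniteMeasure p] [hq : IsFiniteMeasure q]
    (hh : ∀ z, 0 < z → h z = laplace p z - laplace q z) (hC : p.real univ + q.real univ ≤ C) :
    IsSignedLaplace h C := ⟨⟨p, hp⟩, ⟨q, hq⟩, hh, hC⟩

lemma congr (hh : IsSignedLaplace h₁ C₁) (heq : ∀ z, 0 < z → h₂ z = h₁ z) (hC : C₁ ≤ C₂) :
    IsSignedLaplace h₂ C₂ := by
  obtain ⟨p, q, h1, h2⟩ := hh
  exact ⟨p, q, fun z hz => (heq z hz).trans (h1 z hz), h2.trans hC⟩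

lemma nonneg (hh : IsSignedLaplace h C) : 0 ≤ C := by
  obtain ⟨p, q, -, h2⟩ := hh
  exact le_trans (by positivity) h2

lemma add (hh₁ : IsSignedLaplace h₁ C₁) (hh₂ : IsSignedLaplace h₂ C₂) :
    IsSignedLaplace (fun z => h₁ z + h₂ z) (C₁ + C₂) := by
  obtain ⟨p₁, q₁, e₁, b₁⟩ := hh₁
  obtain ⟨p₂, q₂, e₂, b₂⟩ := hh₂
  refine of_measures (p := (p₁ : Measure ℝ≥0) + p₂) (q := (q₁ : Measure ℝ≥0) + q₂)
    (fun z hz => ?_) ?_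
  · rw [laplace_add _ _ hz.le, laplace_add _ _ hz.le, e₁ z hz, e₂ z hz]
    ring
  · rw [real_univ_add, real_univ_add]
    linarith

/-- Expand `(p₁ - q₁) ∗ (p₂ - q₂)` and collect the positive and the negative products. -/
lemma mul (hh₁ : IsSignedLaplace h₁ C₁) (hh₂ : IsSignedLaplace h₂ C₂) :
    IsSignedLaplace (fun z => h₁ z * h₂ z) (C₁ * C₂) := by
  have hC := hh₁.nonneg
  obtain ⟨p₁, q₁, e₁, b₁⟩ := hh₁
  obtain ⟨p₂, q₂, e₂, b₂⟩ := hh₂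
  refine of_measures
    (p := ((p₁ : Measure ℝ≥0) ∗ (p₂ : Measure ℝ≥0)) + ((q₁ : Measure ℝ≥0) ∗ (q₂ : Measure ℝ≥0)))
    (q := ((p₁ : Measure ℝ≥0) ∗ (q₂ : Measure ℝ≥0)) + ((q₁ : Measure ℝ≥0) ∗ (p₂ : Measure ℝ≥0)))
    (fun z hz => ?_) ?_
  · rw [laplace_add _ _ hz.le, laplace_add _ _ hz.le]
    simp only [laplace_conv _ _ hz.le]
    rw [e₁ z hz, e₂ z hz]
    ring
  · rw [real_univ_add, real_univ_add]
    simp only [real_univ_conv]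
    refine le_trans (le_of_eq ?_) (mul_le_mul b₁ b₂ (by positivity) hC)
    ring

/-- The Laplace transform of the image of a signed density under a measurable map. -/
lemma of_weight {Ω : Type*} [MeasurableSpace Ω] (P : Measure Ω) {w : Ω → ℝ} {φ : Ω → ℝ≥0}
    (hw : Measurable w) (hwi : Integrable w P) (hφ : Measurable φ) :
    IsSignedLaplace (fun z => ∫ x, w x * Real.exp (-(z * (φ x : ℝ))) ∂P) (∫ x, |w x| ∂P) := by
  have main : ∀ v : Ω → ℝ, Measurable v → Integrable v P → ∃ p : Measure ℝ≥0, IsFiniteMeasure p ∧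
      ∀ z, 0 ≤ z → laplace p z = ∫ x, max (v x) 0 * Real.exp (-(z * (φ x : ℝ))) ∂P := by
    intro v hv hvi
    have hfin := isFiniteMeasure_withDensity_ofReal hvi.2
    refine ⟨(P.withDensity fun x => ENNReal.ofReal (v x)).map φ, inferInstance, fun z hz => ?_⟩
    rw [laplace, integral_map hφ.aemeasurable (by fun_prop),
      integral_withDensity_eq_integral_toReal_smul (by fun_prop)
        (Eventually.of_forall fun x => ENNReal.ofReal_lt_top)]
    refine integral_congr_ae (Eventually.of_forall fun x => ?_)
    simp only [ENNReal.toReal_ofReal', smul_eq_mul]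
  obtain ⟨p, hp, hpL⟩ := main w hw hwi
  obtain ⟨q, hq, hqL⟩ := main (fun x => -w x) hw.neg hwi.neg
  have hbd : ∀ v : Ω → ℝ, Measurable v → Integrable v P → ∀ z : ℝ, 0 ≤ z →
      Integrable (fun x => max (v x) 0 * Real.exp (-(z * (φ x : ℝ)))) P := by
    intro v hv hvi z hz
    refine hvi.pos_part.mono (by fun_prop) (Eventually.of_forall fun x => ?_)
    rw [norm_mul, Real.norm_eq_abs (Real.exp _), Real.abs_exp]
    refine mul_le_of_le_one_right (norm_nonneg _) (Real.exp_le_one_iff.2 ?_)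
    have := mul_nonneg hz (φ x).2
    simpa using this
  have habs : ∀ x : ℝ, max x 0 - max (-x) 0 = x ∧ max x 0 + max (-x) 0 = |x| := fun x => by
    rcases le_total x 0 with h | h
    · rw [max_eq_right h, max_eq_left (neg_nonneg.2 h), abs_of_nonpos h]; constructor <;> ring
    · rw [max_eq_left h, max_eq_right (neg_nonpos.2 h), abs_of_nonneg h]; constructor <;> ring
  refine of_measures (p := p) (q := q) (fun z hz => ?_) (le_of_eq ?_)
  · rw [hpL z hz.le, hqL z hz.le, ← integral_sub (hbd w hw hwi z hz.le)
      (hbd (fun x => -w x) hw.neg hwi.neg z hz.le)]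
    refine integral_congr_ae (Eventually.of_forall fun x => ?_)
    simp only
    rw [← sub_mul, (habs _).1]
  · rw [← laplace_zero, ← laplace_zero, hpL 0 le_rfl, hqL 0 le_rfl,
      ← integral_add (hbd w hw hwi 0 le_rfl) (hbd (fun x => -w x) hw.neg hwi.neg 0 le_rfl)]
    refine integral_congr_ae (Eventually.of_forall fun x => ?_)
    simp only [zero_mul, neg_zero, Real.exp_zero, mul_one]
    exact (habs _).2

lemma const_mul (hh : IsSignedLaplace h C) (c : ℝ) :
    IsSignedLaplace (fun z => c * h z) (|c| * C) := by
  -- The constant `c` is the transform of `c` times the unit mass at `0`, obtained from a one-point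
  -- space.
  have hc := of_weight (Measure.dirac ()) (w := fun _ => c) (φ := fun _ => 0) measurable_const
    (integrable_dirac (by simp)) measurable_const
  exact (hc.mul hh).congr (fun z _ => by simp) (le_of_eq (by simp))

/-- The Laplace transform of a nonnegative density on a subset of `(0, ∞)`. -/
lemma of_density {s : Set ℝ} (hs : MeasurableSet s) (hs0 : s ⊆ Ioi 0) {w : ℝ → ℝ}
    (hw : Measurable w) (hw0 : ∀ u ∈ s, 0 ≤ w u) (hwi : IntegrableOn w s) :
    IsSignedLaplace (fun z => ∫ u in s, w u * Real.exp (-(z * u))) (∫ u in s, w u) := by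
  refine (of_weight (volume.restrict s) hw hwi measurable_real_toNNReal).congr (fun z _ => ?_)
    (le_of_eq ?_)
  · refine setIntegral_congr_fun hs fun u hu => ?_
    simp only [Real.coe_toNNReal _ (le_of_lt (mem_Ioi.1 (hs0 hu)))]
  · exact setIntegral_congr_fun hs fun u hu => abs_of_nonneg (hw0 u hu)

lemma exp_neg_mul (t : ℝ≥0) : IsSignedLaplace (fun z => Real.exp (-(z * (t : ℝ)))) 1 :=
  of_measures (p := Measure.dirac t) (q := 0) (fun z _ => by simp [laplace]) (by simp)

end IsSignedLaplace

/-! ### Dividing `Lμ(z) - e^{-tz}` by `z` and `z²` -/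

section Centered

variable {μ : FiniteMeasure ℝ≥0} {t : ℝ≥0} {V : ℝ}

lemma interpolation_nonneg (s t : ℝ≥0) {θ : ℝ} (hθ : θ ∈ Ioc (0 : ℝ) 1) :
    0 ≤ (s : ℝ) + θ * (t - s) := by
  have h1 := mul_nonneg (sub_nonneg.2 hθ.2) s.2
  have h2 := mul_nonneg hθ.1.le t.2
  simp only [NNReal.val_eq_coe] at h1 h2
  nlinarith

/-- A weight on the segments from the points of the support of `μ` to `t`. -/
lemma isSignedLaplace_segments {v : ℝ≥0 → ℝ} (hv : Measurable v)
    (hvi : Integrable v (μ : Measure ℝ≥0)) {k : ℝ → ℝ} (hk : Continuous k) :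
    IsSignedLaplace (fun z => ∫ s, v s * (∫ θ in (0 : ℝ)..1, k θ *
      Real.exp (-(z * ((s : ℝ) + θ * (t - s))))) ∂(μ : Measure ℝ≥0))
      ((∫ s, |v s| ∂(μ : Measure ℝ≥0)) * ∫ θ in (0 : ℝ)..1, |k θ|) := by
  have hki : Integrable k (volume.restrict (Ioc (0 : ℝ) 1)) :=
    (hk.integrableOn_Icc (a := 0) (b := 1)).mono_set Ioc_subset_Icc_self
  let φ : ℝ≥0 × ℝ → ℝ≥0 := fun x => ((x.1 : ℝ) + x.2 * (t - x.1)).toNNReal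
  have hφ : Measurable φ := by fun_prop
  have hwi : Integrable (fun x : ℝ≥0 × ℝ => v x.1 * k x.2)
      ((μ : Measure ℝ≥0).prod (volume.restrict (Ioc (0 : ℝ) 1))) := hvi.mul_prod hki
  have hwm : Measurable (fun x : ℝ≥0 × ℝ => v x.1 * k x.2) := by
    have := hk.measurable
    fun_prop
  refine (IsSignedLaplace.of_weight _ hwm hwi hφ).congr (fun z hz => ?_) (le_of_eq ?_)
  · rw [integral_prod]
    · refine integral_congr_ae (Eventually.of_forall fun s => ?_)
      simp only
      rw [intervalIntegral.integral_of_le zero_le_one, ← integral_const_mul]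
      refine setIntegral_congr_fun measurableSet_Ioc fun θ hθ => ?_
      simp only [φ, Real.coe_toNNReal _ (interpolation_nonneg s t hθ)]
      ring
    · refine hwi.mono (by fun_prop) (Eventually.of_forall fun x => ?_)
      rw [norm_mul, Real.norm_eq_abs (Real.exp _), Real.abs_exp]
      refine mul_le_of_le_one_right (norm_nonneg _) (Real.exp_le_one_iff.2 ?_)
      have := mul_nonneg hz.le (φ x).2
      simpa using this
  · simp only [abs_mul]
    rw [integral_prod_mul (fun s => |v s|) (fun θ => |k θ|),
      intervalIntegral.integral_of_le zero_le_one]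

variable [IsProbabilityMeasure (μ : Measure ℝ≥0)]

lemma isSignedLaplace_sub_exp :
    IsSignedLaplace (fun z => laplace (μ : Measure ℝ≥0) z - Real.exp (-(z * (t : ℝ)))) 2 :=
  IsSignedLaplace.of_measures (p := (μ : Measure ℝ≥0)) (q := Measure.dirac t)
    (fun z _ => by simp [laplace]) (by simp; norm_num)

/-- `(e^{-zs} - e^{-zt})/z = (t - s) ∫₀¹ e^{-z(s + θ(t-s))} dθ`, so the total variation is at most
`E|s - t|`. -/
lemma isSignedLaplace_sub_exp_div (hmem : MemLp (fun s : ℝ≥0 => (s : ℝ)) 2 (μ : Measure ℝ≥0))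
    (hV : ∫ s, ((s : ℝ) - t) ^ 2 ∂(μ : Measure ℝ≥0) = V) :
    IsSignedLaplace
      (fun z => (laplace (μ : Measure ℝ≥0) z - Real.exp (-(z * (t : ℝ)))) / z) (√V) := by
  have hvi : Integrable (fun s : ℝ≥0 => (t : ℝ) - s) (μ : Measure ℝ≥0) :=
    (integrable_const _).sub (hmem.integrable one_le_two)
  refine (isSignedLaplace_segments (t := t) (by fun_prop) hvi
    (continuous_const (y := (1 : ℝ)))).congr (fun z hz => ?_) ?_
  · have hint : ∀ s : ℝ≥0, ((t : ℝ) - s) * (∫ θ in (0 : ℝ)..1, 1 *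
        Real.exp (-(z * ((s : ℝ) + θ * (t - s))))) =
        (Real.exp (-(z * (s : ℝ))) - Real.exp (-(z * (t : ℝ)))) / z := by
      intro s
      rw [← intervalIntegral.integral_const_mul]
      have hd : ∀ θ : ℝ, HasDerivAt (fun θ : ℝ => -(Real.exp (-(z * ((s : ℝ) + θ * (t - s)))) / z))
          (((t : ℝ) - s) * (1 * Real.exp (-(z * ((s : ℝ) + θ * (t - s)))))) θ := by
        intro θ
        have := ((((((hasDerivAt_id θ).mul_const ((t : ℝ) - s)).const_add (s : ℝ)).const_mul
          z).neg).exp.div_const z).neg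
        refine this.congr_deriv ?_
        simp only [Pi.neg_apply, id]
        field_simp
      rw [intervalIntegral.integral_eq_sub_of_hasDerivAt (fun θ _ => hd θ)
        (Continuous.intervalIntegrable (by fun_prop) _ _)]
      have h1 : (s : ℝ) + 1 * (t - s) = t := by ring
      rw [h1, zero_mul, add_zero]
      ring
    simp only [hint]
    rw [integral_div, integral_sub (integrable_exp_neg _ hz.le) (integrable_const _)]
    simp [laplace]
  · have := integral_abs_sub_le hmem hV
    simpa [abs_sub_comm] using this

/-- The weight `(s - t)² θ` on the segment from `s` to `t` represents `(e^{-zs} - e^{-zt})/z²` up to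
the term `(t - s) e^{-zt}/z`, whose mean is zero. The constant is `∫₀¹ θ dθ = 1/2`. -/
lemma isSignedLaplace_sub_exp_div_sq (hmem : MemLp (fun s : ℝ≥0 => (s : ℝ)) 2 (μ : Measure ℝ≥0))
    (hmean : ∫ s, (s : ℝ) ∂(μ : Measure ℝ≥0) = t)
    (hV : ∫ s, ((s : ℝ) - t) ^ 2 ∂(μ : Measure ℝ≥0) = V) :
    IsSignedLaplace
      (fun z => (laplace (μ : Measure ℝ≥0) z - Real.exp (-(z * (t : ℝ)))) / z ^ 2) (V / 2) := by
  have hi : Integrable (fun s : ℝ≥0 => (t : ℝ) - s) (μ : Measure ℝ≥0) :=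
    (integrable_const _).sub (hmem.integrable one_le_two)
  have hvi : Integrable (fun s : ℝ≥0 => ((s : ℝ) - t) ^ 2) (μ : Measure ℝ≥0) :=
    (hmem.sub (memLp_const (t : ℝ))).integrable_sq
  have hei : ∀ z : ℝ, 0 < z → Integrable (fun s : ℝ≥0 =>
      (Real.exp (-(z * (s : ℝ))) - Real.exp (-(z * (t : ℝ)))) / z ^ 2) (μ : Measure ℝ≥0) :=
    fun z hz => ((integrable_exp_neg _ hz.le).sub (integrable_const _)).div_const _
  refine (isSignedLaplace_segments (t := t) (by fun_prop) hvi
    (continuous_id (X := ℝ))).congr (fun z hz => ?_) ?_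
  · have hint : ∀ s : ℝ≥0, ((s : ℝ) - t) ^ 2 * (∫ θ in (0 : ℝ)..1, id θ *
        Real.exp (-(z * ((s : ℝ) + θ * (t - s))))) =
        (Real.exp (-(z * (s : ℝ))) - Real.exp (-(z * (t : ℝ)))) / z ^ 2 -
          ((t : ℝ) - s) * (Real.exp (-(z * (t : ℝ))) / z) := by
      intro s
      rw [← intervalIntegral.integral_const_mul]
      have hd : ∀ θ : ℝ, HasDerivAt (fun θ : ℝ =>
          -(((t : ℝ) - s) * θ / z + 1 / z ^ 2) * Real.exp (-(z * ((s : ℝ) + θ * (t - s)))))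
          (((s : ℝ) - t) ^ 2 * (id θ * Real.exp (-(z * ((s : ℝ) + θ * (t - s)))))) θ := by
        intro θ
        have h1 := ((((hasDerivAt_id θ).mul_const ((t : ℝ) - s)).const_add (s : ℝ)).const_mul
          z).neg.exp
        have h2 := ((((hasDerivAt_id θ).const_mul ((t : ℝ) - s)).div_const z).add_const
          (1 / z ^ 2)).neg
        refine (h2.mul h1).congr_deriv ?_
        simp only [Pi.neg_apply, id]
        field_simp
        ring
      rw [intervalIntegral.integral_eq_sub_of_hasDerivAt (fun θ _ => hd θ)
        (Continuous.intervalIntegrable (by fun_prop) _ _)]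
      have h1 : (s : ℝ) + 1 * (t - s) = t := by ring
      rw [h1, zero_mul, add_zero]
      ring
    simp only [hint]
    rw [integral_sub (hei z hz) (hi.mul_const _), integral_div, integral_mul_const,
      integral_sub (integrable_exp_neg _ hz.le) (integrable_const _),
      integral_sub (integrable_const _) (hmem.integrable one_le_two), hmean]
    simp [laplace]
  · have h1 : ∫ θ in (0 : ℝ)..1, |id θ| = 1 / 2 := by
      rw [intervalIntegral.integral_congr (g := fun θ : ℝ => θ)]
      · simp
      · intro θ hθ
        rw [uIcc_of_le zero_le_one] at hθ
        exact abs_of_nonneg hθ.1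
    simp only [abs_sq, hV, h1]
    exact le_of_eq (by ring)

end Centered

/-! ### Fractional powers -/

/-- Log-convexity between `x` and `x + 1` with weights `x - 1` and `2 - x`, followed by the
arithmetic-geometric inequality, gives `1 = Γ(2) ≤ Γ(x)(3x - 1 - x²)`; the last factor is at most
`5/4`, attained at `x = 3/2`. -/
lemma four_fifths_le_Gamma {x : ℝ} (hx : x ∈ Icc (1 : ℝ) 2) : 4 / 5 ≤ Real.Gamma x := by
  rcases hx.1.eq_or_lt with rfl | h1
  · rw [Real.Gamma_one]; norm_num
  rcases hx.2.eq_or_lt with rfl | h2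
  · rw [Real.Gamma_two]; norm_num
  have hx0 : 0 < x := by linarith
  have hG : 0 < Real.Gamma x := Real.Gamma_pos_of_pos hx0
  have h := Real.Gamma_mul_add_mul_le_rpow_Gamma_mul_rpow_Gamma hx0 (by linarith : 0 < x + 1)
    (by linarith : 0 < x - 1) (by linarith : 0 < 2 - x) (by ring)
  have h' := Real.geom_mean_le_arith_mean2_weighted (by linarith : 0 ≤ x - 1)
    (by linarith : 0 ≤ 2 - x) hG.le (by positivity : 0 ≤ x * Real.Gamma x) (by ring)
  rw [Real.Gamma_add_one hx0.ne', show (x - 1) * x + (2 - x) * (x + 1) = 2 by ring,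
    Real.Gamma_two] at h
  nlinarith [mul_nonneg hG.le (sq_nonneg (x - 3 / 2))]

/-- The left side collects the total variations in `isSignedLaplace_sub_exp_mul_rpow`. It is at most
`3` for `α ≥ 1`, and so is `α` times it for `α ≤ 1`, where `αΓ(α) = Γ(α + 1)`; and `3 ≤ 4 · 4/5`. -/
lemma fractional_constant_le {α : ℝ} (h0 : 0 < α) (h2 : α < 2) :
    2 / α + 1 + |α - 1| ≤ 4 * Real.Gamma α := by
  rcases le_total α 1 with h | h
  · have hG := four_fifths_le_Gamma (x := α + 1) ⟨by linarith, by linarith⟩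
    rw [Real.Gamma_add_one h0.ne'] at hG
    rw [abs_of_nonpos (by linarith)]
    refine le_of_mul_le_mul_left ?_ h0
    have : α * (2 / α + 1 + -(α - 1)) = 2 + α * (2 - α) := by field_simp; ring
    rw [this]
    nlinarith [sq_nonneg (α - 1)]
  · have hG := four_fifths_le_Gamma (x := α) ⟨h, h2.le⟩
    rw [abs_of_nonneg (by linarith)]
    have : 2 / α + α ≤ 3 := by
      rw [div_add' _ _ _ h0.ne', div_le_iff₀ h0]
      nlinarith
    linarith

lemma integrableOn_rpow_mul_exp {α z : ℝ} (hα : 0 < α) (hz : 0 < z) :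
    IntegrableOn (fun u : ℝ => u ^ (α - 1) * Real.exp (-(z * u))) (Ioi 0) := by
  -- The integral of a non-integrable function is `0` by convention, so a nonzero value proves
  -- integrability.
  refine Integrable.of_integral_ne_zero ?_
  rw [Real.integral_rpow_mul_exp_neg_mul_Ioi hα hz]
  have := Real.Gamma_pos_of_pos hα
  positivity

/-- Two integrations by parts. They replace `u^{α-1}` by `u^{α-3}`, which is integrable at infinity
without the exponential because `α < 2`. -/
lemma integral_Ioi_rpow_mul_exp {α σ z : ℝ} (hα : 0 < α) (h2 : α < 2) (hσ : 0 < σ) (hz : 0 < z) :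
    ∫ u in Ioi σ, u ^ (α - 1) * Real.exp (-(z * u)) =
      σ ^ (α - 1) * (Real.exp (-(z * σ)) / z) + (α - 1) * σ ^ (α - 2) *
        (Real.exp (-(z * σ)) / z ^ 2) + (α - 1) * (α - 2) *
        (∫ u in Ioi σ, u ^ (α - 3) * Real.exp (-(z * u))) / z ^ 2 := by
  have hi1 : IntegrableOn (fun u : ℝ => u ^ (α - 1) * Real.exp (-(z * u))) (Ioi σ) :=
    (integrableOn_rpow_mul_exp hα hz).mono_set (Ioi_subset_Ioi hσ.le)
  have hi3 : IntegrableOn (fun u : ℝ => u ^ (α - 3) * Real.exp (-(z * u))) (Ioi σ) := by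
    refine Integrable.mono (integrableOn_Ioi_rpow_of_lt (by linarith : α - 3 < -1) hσ)
      (by fun_prop) ?_
    refine (ae_restrict_mem measurableSet_Ioi).mono fun u hu => ?_
    rw [norm_mul, Real.norm_eq_abs (Real.exp _), Real.abs_exp]
    refine mul_le_of_le_one_right (norm_nonneg _) (Real.exp_le_one_iff.2 ?_)
    have := mul_pos hz (hσ.trans hu)
    linarith
  let F : ℝ → ℝ := fun u => u ^ (α - 1) * Real.exp (-(z * u)) / z +
    (α - 1) * (u ^ (α - 2) * Real.exp (-(z * u))) / z ^ 2
  have hderiv : ∀ u ∈ Ici σ, HasDerivAt F (-(u ^ (α - 1) * Real.exp (-(z * u))) +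
      (α - 1) * (α - 2) * (u ^ (α - 3) * Real.exp (-(z * u))) / z ^ 2) u := by
    intro u hu
    have hu0 : u ≠ 0 := (hσ.trans_le hu).ne'
    have he : HasDerivAt (fun u : ℝ => Real.exp (-(z * u))) (Real.exp (-(z * u)) * -z) u := by
      simpa using ((hasDerivAt_id u).const_mul z).neg.exp
    have h1 := ((Real.hasDerivAt_rpow_const (p := α - 1) (Or.inl hu0)).mul he).div_const z
    have h2 := (((Real.hasDerivAt_rpow_const (p := α - 2) (Or.inl hu0)).mul he).const_mul
      (α - 1)).div_const (z ^ 2)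
    refine (h1.add h2).congr_deriv ?_
    rw [show α - 1 - 1 = α - 2 by ring, show α - 2 - 1 = α - 3 by ring]
    field_simp
    ring
  have hlim : Tendsto F atTop (𝓝 0) := by
    have ha := (tendsto_rpow_mul_exp_neg_mul_atTop_nhds_zero (α - 1) z hz).div_const z
    have hb := ((tendsto_rpow_mul_exp_neg_mul_atTop_nhds_zero (α - 2) z hz).const_mul
      (α - 1)).div_const (z ^ 2)
    simpa [F, neg_mul] using ha.add hb
  have key := integral_Ioi_of_hasDerivAt_of_tendsto
    (hderiv σ self_mem_Ici).continuousAt.continuousWithinAt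
    (fun u hu => hderiv u (le_of_lt (mem_Ioi.1 hu)))
    (hi1.neg.add ((hi3.const_mul ((α - 1) * (α - 2))).div_const (z ^ 2))) hlim
  have hsum : ∫ u in Ioi σ, (-(u ^ (α - 1) * Real.exp (-(z * u))) +
      (α - 1) * (α - 2) * (u ^ (α - 3) * Real.exp (-(z * u))) / z ^ 2) =
      -(∫ u in Ioi σ, u ^ (α - 1) * Real.exp (-(z * u))) + (α - 1) * (α - 2) *
        (∫ u in Ioi σ, u ^ (α - 3) * Real.exp (-(z * u))) / z ^ 2 := by
    have hn1 : IntegrableOn (fun u : ℝ => -(u ^ (α - 1) * Real.exp (-(z * u)))) (Ioi σ) := hi1.neg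
    rw [integral_add hn1 ((hi3.const_mul ((α - 1) * (α - 2))).div_const (z ^ 2)),
      integral_neg, integral_div, integral_const_mul]
  rw [hsum] at key
  simp only [F] at key
  linear_combination -key

/-- A truncated form of the integral representation of `z^{-α}`. -/
lemma Gamma_mul_rpow_neg {α σ z : ℝ} (hα : 0 < α) (h2 : α < 2) (hσ : 0 < σ) (hz : 0 < z) :
    Real.Gamma α * z ^ (-α) = (∫ u in Ioc 0 σ, u ^ (α - 1) * Real.exp (-(z * u))) +
      σ ^ (α - 1) * (Real.exp (-(z * σ)) / z) + (α - 1) * σ ^ (α - 2) *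
        (Real.exp (-(z * σ)) / z ^ 2) + (α - 1) * (α - 2) *
        (∫ u in Ioi σ, u ^ (α - 3) * Real.exp (-(z * u))) / z ^ 2 := by
  have h := Real.integral_rpow_mul_exp_neg_mul_Ioi hα hz
  have hi := integrableOn_rpow_mul_exp hα hz
  rw [← Ioc_union_Ioi_eq_Ioi hσ.le, setIntegral_union (Ioc_disjoint_Ioi le_rfl) measurableSet_Ioi
    (hi.mono_set Ioc_subset_Ioi_self) (hi.mono_set (Ioi_subset_Ioi hσ.le)),
    integral_Ioi_rpow_mul_exp hα h2 hσ hz, one_div, Real.inv_rpow hz.le, ← Real.rpow_neg hz.le] at h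
  linear_combination -h

/-- If `μ` is a probability measure with mean `t` and variance at most `σ²`, then the quotient of
`L μ (z) - e^{-tz}` and `z^α` is the Laplace transform of a signed measure of total variation at
most `4 σ^α`. -/
lemma isSignedLaplace_sub_exp_mul_rpow {μ : FiniteMeasure ℝ≥0}
    [IsProbabilityMeasure (μ : Measure ℝ≥0)] {t : ℝ≥0} {V σ α : ℝ}
    (hmem : MemLp (fun s : ℝ≥0 => (s : ℝ)) 2 (μ : Measure ℝ≥0))
    (hmean : ∫ s, (s : ℝ) ∂(μ : Measure ℝ≥0) = t)
    (hV : ∫ s, ((s : ℝ) - t) ^ 2 ∂(μ : Measure ℝ≥0) = V) (hσ : 0 < σ) (hVσ : V ≤ σ ^ 2)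
    (hα : 0 < α) (h2 : α < 2) :
    IsSignedLaplace (fun z => (laplace (μ : Measure ℝ≥0) z - Real.exp (-(z * (t : ℝ)))) *
      z ^ (-α)) (4 * σ ^ α) := by
  have hG := Real.Gamma_pos_of_pos hα
  have d0 := isSignedLaplace_sub_exp (μ := μ) (t := t)
  have d1 := (isSignedLaplace_sub_exp_div hmem hV).congr (C₂ := σ) (fun z _ => rfl)
    ((Real.sqrt_le_sqrt hVσ).trans_eq (Real.sqrt_sq hσ.le))
  have d2 := (isSignedLaplace_sub_exp_div_sq hmem hmean hV).congr (C₂ := σ ^ 2 / 2)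
    (fun z _ => rfl) (by linarith)
  have e := IsSignedLaplace.exp_neg_mul σ.toNNReal
  have a1 : IsSignedLaplace (fun z => ∫ u in Ioc 0 σ, u ^ (α - 1) * Real.exp (-(z * u)))
      (σ ^ α / α) := by
    have hi : IntegrableOn (fun u : ℝ => u ^ (α - 1)) (Ioc 0 σ) :=
      (intervalIntegrable_iff_integrableOn_Ioc_of_le hσ.le).1
        (intervalIntegral.intervalIntegrable_rpow' (by linarith))
    refine (IsSignedLaplace.of_density measurableSet_Ioc Ioc_subset_Ioi_self (by fun_prop)
      (fun u hu => Real.rpow_nonneg hu.1.le _) hi).congr (fun z _ => rfl) (le_of_eq ?_)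
    rw [← intervalIntegral.integral_of_le hσ.le, integral_rpow (Or.inl (by linarith)),
      sub_add_cancel, Real.zero_rpow hα.ne', sub_zero]
  have a3 : IsSignedLaplace (fun z => ∫ u in Ioi σ, u ^ (α - 3) * Real.exp (-(z * u)))
      (σ ^ (α - 2) / (2 - α)) := by
    refine (IsSignedLaplace.of_density measurableSet_Ioi (Ioi_subset_Ioi hσ.le) (by fun_prop)
      (fun u hu => Real.rpow_nonneg (hσ.trans hu).le _)
      (integrableOn_Ioi_rpow_of_lt (by linarith) hσ)).congr (fun z _ => rfl) (le_of_eq ?_)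
    rw [integral_Ioi_rpow_of_lt (by linarith) hσ, show α - 3 + 1 = -(2 - α) by ring,
      neg_div_neg_eq, neg_sub]
  -- The part over `(0, σ]` meets `D` itself, the first boundary term `D/z`, and the second boundary
  -- term and the tail `D/z²`.
  refine (((((a1.mul d0).add ((e.mul d1).const_mul (σ ^ (α - 1)))).add
    ((e.mul d2).const_mul ((α - 1) * σ ^ (α - 2)))).add
    ((a3.mul d2).const_mul ((α - 1) * (α - 2)))).const_mul (Real.Gamma α)⁻¹).congr
    (fun z hz => ?_) ?_
  · have h := Gamma_mul_rpow_neg hα h2 hσ hz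
    have hz' : z ^ (-α) = (Real.Gamma α)⁻¹ * (Real.Gamma α * z ^ (-α)) := by
      field_simp
    rw [hz', h]
    simp only [Real.coe_toNNReal _ hσ.le]
    ring
  · have p1 : σ ^ (α - 1) * σ = σ ^ α := by
      rw [← Real.rpow_add_one hσ.ne', sub_add_cancel]
    have p2 : σ ^ (α - 2) * σ ^ 2 = σ ^ α := by
      rw [← Real.rpow_add_natCast hσ.ne']
      norm_num
    have h2' : 0 < 2 - α := by linarith
    rw [abs_mul, abs_mul, abs_of_pos (Real.rpow_pos_of_pos hσ (α - 1)),
      abs_of_pos (Real.rpow_pos_of_pos hσ (α - 2)), abs_of_neg (by linarith : α - 2 < 0),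
      abs_of_pos (inv_pos.2 hG)]
    have hle := mul_le_mul_of_nonneg_right (fractional_constant_le hα h2)
      (Real.rpow_nonneg hσ.le α)
    have hsum : σ ^ α / α * 2 + σ ^ (α - 1) * (1 * σ) +
        |α - 1| * σ ^ (α - 2) * (1 * (σ ^ 2 / 2)) +
        |α - 1| * -(α - 2) * (σ ^ (α - 2) / (2 - α) * (σ ^ 2 / 2)) =
        (2 / α + 1 + |α - 1|) * σ ^ α := by
      have : |α - 1| * -(α - 2) * (σ ^ (α - 2) / (2 - α) * (σ ^ 2 / 2)) =
          |α - 1| * (σ ^ (α - 2) * σ ^ 2) / 2 := by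
        field_simp
        ring
      rw [this]
      have : |α - 1| * σ ^ (α - 2) * (1 * (σ ^ 2 / 2)) =
          |α - 1| * (σ ^ (α - 2) * σ ^ 2) / 2 := by ring
      rw [this, p2, one_mul, p1]
      ring
    rw [hsum, inv_mul_le_iff₀ hG]
    linarith

lemma IsLaplace.ofReal {f : ℂ → ℂ} {m : Fin 4 → FiniteMeasure ℝ≥0} (h : IsLaplace f m) {z : ℝ}
    (hz : 0 < z) :
    f z = ∑ k : Fin 4, Complex.I ^ (k : ℕ) * (laplace (m k : Measure ℝ≥0) z : ℂ) := by
  rw [h z (by simpa [rightHalfPlane] using hz)]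
  refine Finset.sum_congr rfl fun k _ => ?_
  rw [laplace, ← integral_complex_ofReal]
  push_cast
  rfl

/-! ### Transfer to operators through a regularizer -/

namespace BoundedC0Semigroup

variable {X : Type*} [NormedAddCommGroup X] [NormedSpace ℂ X] [CompleteSpace X]
  (T : BoundedC0Semigroup X)

/-- An identity `(h₁ - h₂) e = (p - q) (e f)` of Laplace transforms carries over to operators. -/
lemma average_sub_average_eq_of_regularizer {f e : ℂ → ℂ} (he : T.IsRegularizer f e)
    {m₁ m₂ p q : FiniteMeasure ℝ≥0}
    (hL : ∀ z : ℝ, 0 < z → ((laplace (m₁ : Measure ℝ≥0) z - laplace (m₂ : Measure ℝ≥0) z : ℝ) : ℂ) =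
      ((laplace (p : Measure ℝ≥0) z - laplace (q : Measure ℝ≥0) z : ℝ) : ℂ) * f z)
    {x y : X} (hxy : T.hpCalc (fun z => e z * f z) x = T.hpCalc e y) :
    T.average m₁ x - T.average m₂ x = T.average p y - T.average q y := by
  obtain ⟨h1, h2, hinj⟩ := he
  -- After applying `e(A)`, which commutes with averages, and replacing `e(A)y` by `(ef)(A)x`, both
  -- sides are averages of the orbit of `x` over convolutions, so uniqueness of Laplace transforms
  -- applies.
  refine hinj ?_
  have calc1 : ∀ w : X, T.hpCalc e w = ∑ k : Fin 4, Complex.I ^ (k : ℕ) •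
      T.average (h1.choose k) w := fun w => by
    rw [hpCalc, dif_pos h1]; simp
  have calc2 : ∀ w : X, T.hpCalc (fun z => e z * f z) w = ∑ k : Fin 4, Complex.I ^ (k : ℕ) •
      T.average (h2.choose k) w := fun w => by
    rw [hpCalc, dif_pos h2]; simp
  set a := h1.choose
  set b := h2.choose
  have la : IsLaplace e a := h1.choose_spec
  have lb : IsLaplace (fun z => e z * f z) b := h2.choose_spec
  have hcomm : ∀ m : FiniteMeasure ℝ≥0, T.hpCalc e (T.average m y) =
      T.average m (T.hpCalc (fun z => e z * f z) x) := by
    intro m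
    rw [hxy, calc1, calc1, map_sum]
    refine Finset.sum_congr rfl fun k _ => ?_
    rw [map_smul, T.average_comm]
  rw [map_sub, map_sub, hcomm, hcomm, calc1, calc1, calc2]
  let M : Fin 4 × Fin 4 → Measure ℝ≥0 := fun i =>
    ![(a i.1 : Measure ℝ≥0) ∗ (m₁ : Measure ℝ≥0), (a i.1 : Measure ℝ≥0) ∗ (m₂ : Measure ℝ≥0),
      (p : Measure ℝ≥0) ∗ (b i.1 : Measure ℝ≥0), (q : Measure ℝ≥0) ∗ (b i.1 : Measure ℝ≥0)] i.2
  let c : Fin 4 × Fin 4 → ℂ := fun i => ![1, -1, -1, 1] i.2 * Complex.I ^ (i.1 : ℕ)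
  have hM : ∀ i, IsFiniteMeasure (M i) := by
    rintro ⟨k, l⟩
    fin_cases l <;> simp only [M] <;> dsimp <;> infer_instance
  have key := sum_smul_integral_eq_zero c M (fun z hz => ?_) (fun i => T.integrable_op (M i) x)
  · rw [Fintype.sum_prod_type] at key
    simp only [Fin.sum_univ_four (f := fun l : Fin 4 => _), M, c] at key
    simp only [map_sum, map_smul, average_average]
    rw [← sub_eq_zero, ← key]
    simp [Fin.sum_univ_four]
    module
  · have ea := la.ofReal hz
    have eb := lb.ofReal hz
    have h := hL z hz
    rw [Fintype.sum_prod_type]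
    simp only [M, c]
    simp [Fin.sum_univ_four, laplace_conv _ _ hz.le] at ea eb h ⊢
    linear_combination -(laplace (m₁ : Measure ℝ≥0) z - laplace (m₂ : Measure ℝ≥0) z : ℂ) * ea +
      (laplace (p : Measure ℝ≥0) z - laplace (q : Measure ℝ≥0) z : ℂ) * eb + e z * h

/-- Bound for an operator in the Hille-Phillips calculus in terms of the extended calculus. -/
lemma norm_average_sub_average_le_extCalc {f : ℂ → ℂ} {h : ℝ → ℝ} {C : ℝ}
    (hh : IsSignedLaplace h C) {m₁ m₂ : FiniteMeasure ℝ≥0}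
    (hL : ∀ z : ℝ, 0 < z → ((laplace (m₁ : Measure ℝ≥0) z - laplace (m₂ : Measure ℝ≥0) z : ℝ) : ℂ) =
      (h z : ℂ) * f z) :
    ∀ x : (T.extCalc f).domain,
      ‖T.average m₁ x - T.average m₂ x‖ ≤ C * (T.bound * ‖T.extCalc f x‖) := by
  have hC := hh.nonneg
  by_cases hf : DifferentiableOn ℂ f rightHalfPlane ∧ ∃ e, T.IsRegularizer f e
  · rw [show T.extCalc f = T.regularized f _ hf.2.choose_spec from dif_pos hf]
    intro x
    obtain ⟨p, q, hpq, hle⟩ := hh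
    have he := hf.2.choose_spec
    set e := hf.2.choose
    have hxy : T.hpCalc (fun z => e z * f z) x = T.hpCalc e (T.regularized f e he x) := by
      have := LinearEquiv.ofInjective_symm_apply (f := T.hpCalc e) (h := he.2.2)
        ⟨T.hpCalc (fun z => e z * f z) x, x.2⟩
      exact this.symm
    rw [T.average_sub_average_eq_of_regularizer he (p := p) (q := q)
      (fun z hz => by rw [hL z hz, hpq z hz]) hxy]
    refine (norm_sub_le _ _).trans ((add_le_add (T.norm_average_le p _)
      (T.norm_average_le q _)).trans ?_)
    rw [← add_mul]
    exact mul_le_mul_of_nonneg_right hle (mul_nonneg T.bound_nonneg (norm_nonneg _))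
  · rw [show T.extCalc f = ⊥ from dif_neg hf]
    rintro ⟨x, hx⟩
    have : x = 0 := (Submodule.mem_bot ℂ).1 hx
    subst this
    simp only [map_zero, sub_zero, norm_zero]
    exact mul_nonneg hC (mul_nonneg T.bound_nonneg (norm_nonneg _))

/-- The error estimate on the domain of a fractional power. -/
lemma norm_average_sub_op_le_fracPow {μ : FiniteMeasure ℝ≥0}
    [IsProbabilityMeasure (μ : Measure ℝ≥0)] {t : ℝ≥0} {V α : ℝ}
    (hmem : MemLp (fun s : ℝ≥0 => (s : ℝ)) 2 (μ : Measure ℝ≥0))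
    (hmean : ∫ s, (s : ℝ) ∂(μ : Measure ℝ≥0) = t)
    (hV : ∫ s, ((s : ℝ) - t) ^ 2 ∂(μ : Measure ℝ≥0) = V) (hα : 0 < α) (h2 : α < 2)
    (x : (T.fracPow α).domain) :
    ‖T.average μ x - T.op t x‖ ≤ 4 * T.bound * V ^ (α / 2) * ‖T.fracPow α x‖ := by
  have hV0 : 0 ≤ V := by
    rw [← hV]
    exact integral_nonneg fun s => sq_nonneg _
  let δ : FiniteMeasure ℝ≥0 := ⟨Measure.dirac t, inferInstance⟩
  have hδ : T.average δ x = T.op t x := by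
    change ∫ s, T.op s x ∂(Measure.dirac t) = _
    rw [integral_dirac]
  have hδL : ∀ z, laplace (δ : Measure ℝ≥0) z = Real.exp (-(z * (t : ℝ))) := fun z => by
    change ∫ s, Real.exp (-(z * (s : ℝ))) ∂(Measure.dirac t) = _
    rw [integral_dirac]
  -- The splitting level must be positive while `V` may vanish, so the bound is proved for `σ > √V`
  -- and the limit `σ → √V` taken afterwards.
  have hσ : ∀ σ, √V < σ → ‖T.average μ x - T.op t x‖ ≤
      4 * σ ^ α * (T.bound * ‖T.fracPow α x‖) := by
    intro σ hσ
    have hσ0 : 0 < σ := (Real.sqrt_nonneg V).trans_lt hσ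
    rw [← hδ]
    refine T.norm_average_sub_average_le_extCalc (isSignedLaplace_sub_exp_mul_rpow hmem hmean hV hσ0
      (Real.sqrt_lt' hσ0 |>.1 hσ).le hα h2) (fun z hz => ?_) x
    rw [hδL, ← Complex.ofReal_cpow hz.le, ← Complex.ofReal_mul, mul_assoc, ← Real.rpow_add hz,
      neg_add_cancel, Real.rpow_zero, mul_one]
  have hlim : Tendsto (fun σ : ℝ => 4 * σ ^ α * (T.bound * ‖T.fracPow α x‖)) (𝓝[>] √V)
      (𝓝 (4 * √V ^ α * (T.bound * ‖T.fracPow α x‖))) := by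
    have hc : Continuous fun σ : ℝ => 4 * σ ^ α * (T.bound * ‖T.fracPow α x‖) :=
      ((Real.continuous_rpow_const hα.le).const_mul 4).mul_const _
    exact (hc.tendsto _).mono_left nhdsWithin_le_nhds
  have := ge_of_tendsto hlim (eventually_mem_nhdsWithin.mono fun σ h => hσ σ h)
  refine this.trans (le_of_eq ?_)
  rw [Real.sqrt_eq_rpow, ← Real.rpow_mul hV0, one_div_mul_eq_div]
  ring

end BoundedC0Semigroup

end

theorem theorem1p1 {X : Type*} [NormedAddCommGroup X] [NormedSpace ℂ X] [CompleteSpace X]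
    (A : X →ₗ.[ℂ] X) (T : BoundedC0Semigroup X) (hA : T.generator = -A)
    (g : ℝ → ℝ → ℝ) (g₂ : ℝ → ℝ)
    (hg : ∀ t : ℝ, 0 < t → CompletelyMonotone (g t))
    (hg0 : ∀ t : ℝ, 0 < t → HasDerivLimitAtZero 0 (g t) 1)
    (hg1 : ∀ t : ℝ, 0 < t → HasDerivLimitAtZero 1 (g t) (-1))
    (hg2 : ∀ t : ℝ, 0 < t → HasDerivLimitAtZero 2 (g t) (g₂ t))
    (n : ℕ) (hn : 1 ≤ n) (t : ℝ≥0) (ht : 0 < t) :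
    (∀ (x : A.domain) (hx : A x ∈ A.domain),
      ‖T.cmCalc (fun z => g t (t * z / n) ^ n) x - T.op t x‖ ≤
        T.bound * ((g₂ t - 1) / 2) * ((t : ℝ) ^ 2 / n) * ‖A ⟨A x, hx⟩‖) ∧
    (∀ x : A.domain,
      ‖T.cmCalc (fun z => g t (t * z / n) ^ n) x - T.op t x‖ ≤
        T.bound * √(g₂ t - 1) * (t / √n) * ‖A x‖) ∧
    (∀ α : ℝ, 0 < α → α < 2 → ∀ x : (T.fracPow α).domain,
      ‖T.cmCalc (fun z => g t (t * z / n) ^ n) x - T.op t x‖ ≤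
        4 * T.bound * ((g₂ t - 1) * ((t : ℝ) ^ 2 / n)) ^ (α / 2) * ‖T.fracPow α x‖) := by
  obtain rfl : A = -T.generator := by rw [hA, neg_neg]
  have ht' : (0 : ℝ) < t := ht
  obtain ⟨μ, hμ, -, hprob, hmem, hmean, hV⟩ := (hg t ht').bernsteinMeasure_pow (hg0 t ht')
    (hg1 t ht') (hg2 t ht') hn ht
  have hcalc : T.cmCalc (fun z => g t (t * z / n) ^ n) = T.average μ := by
    rw [BoundedC0Semigroup.cmCalc, hμ]
  rw [hcalc]
  refine ⟨fun x hx => ?_, fun x => ?_, fun α hα h2 x => ?_⟩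
  · have hx' : T.generator x ∈ T.generator.domain := by
      have : -T.generator x ∈ T.generator.domain := hx
      simpa using T.generator.domain.neg_mem this
    have key := BoundedC0Semigroup.norm_average_sub_op_le_sq hmem hmean hV x hx'
    have hAA : (-T.generator) ⟨(-T.generator) x, hx⟩ = T.generator ⟨T.generator x, hx'⟩ := by
      have : (⟨(-T.generator) x, hx⟩ : T.generator.domain) = -⟨T.generator x, hx'⟩ := rfl
      rw [LinearPMap.neg_apply, this, LinearPMap.map_neg, neg_neg]
    rw [hAA]
    refine key.trans (le_of_eq ?_)
    ring
  · have key := BoundedC0Semigroup.norm_average_sub_op_le hmem hV x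
    rw [LinearPMap.neg_apply, norm_neg]
    refine key.trans (le_of_eq ?_)
    rw [Real.sqrt_mul' _ (by positivity), Real.sqrt_div (by positivity), Real.sqrt_sq ht'.le]
    ring
  · exact T.norm_average_sub_op_le_fracPow hmem hmean hV hα h2 x
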